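/- **Model.** Fix integers $R,K,d\ge 1$, $D=Rd$, weights $\pi(r)>0$ with $\sum_{r=1}^R\pi(r)=1$, weights $\pi_r(k)>0$ with $\sum_{k=1}^K\pi_r(k)=1$, and vectors $x_{r,k}\in\mathbb R^{D}$ ($r\in[R]$, $k\in[K]$). The $RK\times D$ matrix with rows $x_{r,k}^\top$ is written as $Z+\mathcal A$, where $Z$ is block diagonal with diagonal blocks $\xi_1,\dots,\xi_R\in\mathbb R^{K\times d}$ and the Hadamard product $Z\circ\mathcal A$ is $0$. Let $M\le R$ be the number of distinct elements of $\{\xi_1,\dots,\xi_R\}$ (the motifs). Let $F=\sum_r\pi(r)\sum_k\pi_r(k)\,\delta_{x_{r,k}}$. Assume that * all inner products $\langle x_{r,k},x_{s,l}\rangle$ lie in $[0,1]$; * (affinity) $p:=\max_{r\ne s}\max_{k,l}\langle x_{r,k},x_{s,l}\rangle<q:=\min_r\min_{k,l}\langle x_{r,k},x_{r,l}\rangle$; * the second moment matrix $\int xx^\top\,dF(x)$ has rank $D$. For each $n$ let $X_1,\dots,X_n$ be i.i.d. with law $F$ and, given $X$, let $G=G_n$ be the random graph on $[n]$ with independent edges,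 $ij$ being an edge with probability $\langle X_i,X_j\rangle$; let $A$ be its adjacency matrix. Let $H_r=\{i: X_i\in\{x_{r,1},\dots,x_{r,K}\}\}$. All parameters are fixed as $n\to\infty$. Events $E_n$ occur *asymptotically almost surely* if for every $c>0$ there is $n_0(c)$ such that $P(E_n)\ge 1-\eta$ whenever $n>n_0(c)$ and $n^{-c}<\eta<1/2$. **Algorithm.** An adjacency spectral embedding (ASE) into $\mathbb R^m$ of a symmetric matrix $B$ is $U S^{1/2}$, where $S$ is the diagonal matrix of the $m$ largest eigenvalues of $|B|=(B^\top B)^{1/2}$ in decreasing order and the columns of $U$ are corresponding orthonormal eigenvectors. 1. Compute an ASE of $A$ into $\mathbb R^D$, with rows $\widehat X_1,\dots,\widehat X_n$. 2. Start with a family of $R$ seeds that are rows of $\widehat X$ (repetitions allowed). For $i=1,\dots,n$, choose two different members $\tilde y,\tilde z$ of the family with maximal inner product; if $\max_s\langle\widehat X_i,s\rangle<\langle\tilde y,\tilde z\rangle$, the maximum being over all seeds $s$, replace $\tilde z$ by $\widehat X_i$; if it is $>$, do nothing; in case of equality do either. With the final seeds $s_1,\dots,s_R$, assign every vertex $i$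 to an index $j$ maximizing $\langle\widehat X_i,s_j\rangle$. Let $\widehat H_j$ consist of the vertex of $s_j$ and all vertices assigned to $j$. 3. For each $j$ compute an ASE $\widehat X_{\widehat H_j}$ into $\mathbb R^d$ of the adjacency matrix of the subgraph induced by $\widehat H_j$. 4. Let $\widehat S_{jk}=T(\widehat X_{\widehat H_j},\widehat X_{\widehat H_k})$, where for point families $(u_i)_{i\le a}$, $(v_k)_{k\le b}$ $$T(u,v)=\frac{1}{a(a-1)}\sum_{i\ne j}\kappa(u_i,u_j)-\frac{2}{ab}\sum_{i,k}\kappa(u_i,v_k)+\frac1{b(b-1)}\sum_{k\neq l}\kappa(v_k,v_l)$$ and $\kappa(u,v)=\varphi(\|u-v\|)$ is a radial kernel with $\varphi$ continuous (e.g. Gaussian). **Theorem.** (a) Asymptotically almost surely, the clustering is perfect: for all choices made in the algorithm (eigenvectors, initial seeds, ties) there is a permutation $\sigma$ of $[R]$ with $\widehat H_{\sigma(r)}=H_r$ for all $r\in[R]$. (b) Suppose in addition that every subgraph is $d$-dimensional, i.e. $\dim\operatorname{span}\{x_{r,1},\dots,x_{r,K}\}\le d$ for all $r$ (automatic if $\mathcal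 A=0$ or $K=d$). Then for every $\varepsilon>0$, asymptotically almost surely, for all choices made in the algorithm there is a permutation $\sigma$ as in (a) such that $$|\widehat S_{\sigma(r)\sigma(s)}-S_{rs}|\le\varepsilon\quad\text{for all } r,s\in[R],\qquad S_{rs}=T(Y_{H_r},Y_{H_s}).$$ Here $Y_{H_r}=(Y_i)_{i\in H_r}$ are the true latent positions of $H_r$ in $\mathbb R^d$, i.e. $\langle Y_i,Y_j\rangle=\langle X_i,X_j\rangle$ for $i,j\in H_r$; this determines them up to an orthogonal transformation, and $Y_{H_r}$ is any representative that is closest in Frobenius norm to $\widehat X_{\widehat H_{\sigma(r)}}$. -/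

import Mathlib

open MeasureTheory ProbabilityTheory

/-- "Asymptotically almost surely", in the quantitative sense: for every fixed `c > 0` there is
`n₀(c)` such that `P(Eₙ) ≥ 1 - η` whenever `n > n₀(c)` and `n ^ (-c) < η < 1/2`. -/
def AsympAlmostSurely {Ω : ℕ → Type*} [∀ n, MeasurableSpace (Ω n)]
    (μ : ∀ n, Measure (Ω n)) (E : ∀ n, Set (Ω n)) : Prop :=
  ∀ c : ℝ, 0 < c → ∃ n₀ : ℕ, ∀ n : ℕ, n₀ < n → ∀ η : ℝ,
    (n : ℝ) ^ (-c) < η → η < 1 / 2 → 1 - η ≤ (μ n).real (E n)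

section RandomDotProductGraph

/-- `∏_{i > j} ⟨x i, x j⟩ ^ {A_ij} (1 - ⟨x i, x j⟩) ^ {1 - A_ij}`, with `A` the adjacency matrix
of `G`. -/
noncomputable def edgeLikelihood {ι : Type*} [Fintype ι] {n : ℕ}
    (x : Fin n → EuclideanSpace ℝ ι) (G : SimpleGraph (Fin n)) : ℝ :=
  open Classical in
  ∏ i, ∏ j ∈ Finset.univ.filter (fun j => j < i),
    if G.Adj i j then inner ℝ (x i) (x j) else 1 - inner ℝ (x i) (x j)

/-- `(X, A) ∼ RDPG(F)` on `n` vertices: the latent positions `X i` are i.i.d. with law `F`, where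
`F` lives on a set with all inner products in `[0, 1]`, and given `X` the graph `A` is drawn with
independent edges, the edge `{i, j}` having probability `⟨X i, X j⟩`. -/
structure IsRDPG {ι : Type*} [Fintype ι] {n : ℕ} {Ω : Type*} [MeasurableSpace Ω]
    (F : Measure (EuclideanSpace ℝ ι)) (μ : Measure Ω)
    (X : Fin n → Ω → EuclideanSpace ℝ ι) (A : Ω → SimpleGraph (Fin n)) : Prop where
  admissible : ∃ 𝒳 : Set (EuclideanSpace ℝ ι), F 𝒳ᶜ = 0 ∧
    ∀ x ∈ 𝒳, ∀ y ∈ 𝒳, inner ℝ x y ∈ Set.Icc (0 : ℝ) 1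
  measurable_position : ∀ i, Measurable (X i)
  indep : iIndepFun X μ
  law : ∀ i, μ.map (X i) = F
  measurable_graph : ∀ G, MeasurableSet {ω | A ω = G}
  conditional_law : ∀ (B : Set (Fin n → EuclideanSpace ℝ ι)), MeasurableSet B →
    ∀ G : SimpleGraph (Fin n),
      μ {ω | (fun i => X i ω) ∈ B ∧ A ω = G} =
        ∫⁻ ω in {ω | (fun i => X i ω) ∈ B},
          ENNReal.ofReal (edgeLikelihood (fun i => X i ω) G) ∂μ

/-- The second moment matrix `E[X₁ X₁ᵀ]` of a distribution `F`. -/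
noncomputable def secondMoment {ι : Type*} [Fintype ι] (F : Measure (EuclideanSpace ℝ ι)) :
    Matrix ι ι ℝ :=
  Matrix.of fun a b => ∫ x, x a * x b ∂F

end RandomDotProductGraph

section HSBM

variable {R K d : ℕ}

/-- The entries of the block diagonal matrix `Z`; rows are indexed by (subgraph, block), columns
by `Fin R × Fin d`, so that the ambient dimension is `D = R d`. -/
def blockDiagEntry (ξ : Fin R → Fin K → Fin d → ℝ) (r : Fin R) (k : Fin K)
    (c : Fin R × Fin d) : ℝ :=
  if c.1 = r then ξ r k c.2 else 0

/-- The rows of `Z + 𝒜`: the latent position of block `k` of subgraph `r`. -/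
noncomputable def latentPosition (ξ : Fin R → Fin K → Fin d → ℝ)
    (𝒜 : Fin R → Fin K → Fin R × Fin d → ℝ) (r : Fin R) (k : Fin K) :
    EuclideanSpace ℝ (Fin R × Fin d) :=
  WithLp.toLp 2 fun c => blockDiagEntry ξ r k c + 𝒜 r k c

/-- `F = ∑ᵣ π(r) ∑ₖ πᵣ(k) δ_{x r k}`. -/
noncomputable def hsbmLaw {ι : Type*} [Fintype ι] (π : Fin R → ℝ) (πs : Fin R → Fin K → ℝ)
    (x : Fin R → Fin K → EuclideanSpace ℝ ι) : Measure (EuclideanSpace ℝ ι) :=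
  ∑ r, ENNReal.ofReal (π r) • ∑ k, ENNReal.ofReal (πs r k) • Measure.dirac (x r k)

/-- Affinity: the largest inner product `p` of latent positions in different subgraphs is smaller
than the smallest inner product `q` of latent positions in the same subgraph. -/
def Affinity {ι : Type*} [Fintype ι] (x : Fin R → Fin K → EuclideanSpace ℝ ι) : Prop :=
  ∃ p q : ℝ,
    IsLeast {t | ∃ r k l, t = inner ℝ (x r k) (x r l)} q ∧
    IsGreatest {t | ∃ r s k l, r ≠ s ∧ t = inner ℝ (x r k) (x s l)} p ∧
    p < q

/-- The vertex set of the `r`-th subgraph, for latent positions `X` of the vertices. -/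
noncomputable def trueSubgraph {ι : Type*} [Fintype ι] {n : ℕ}
    (x : Fin R → Fin K → EuclideanSpace ℝ ι) (X : Fin n → EuclideanSpace ℝ ι) (r : Fin R) :
    Finset (Fin n) :=
  open Classical in Finset.univ.filter fun i => ∃ k, X i = x r k

end HSBM

section Algorithm

/-- `Xhat = U_A S_A^{1/2}` is an adjacency spectral embedding of `A` into `ℝᵈ`. Here `B = |A|` is
the positive semidefinite square root of `Aᵀ A`, `lam` lists its eigenvalues in decreasing order
and `u` is a corresponding orthonormal basis of eigenvectors (any choice of it is allowed).
If there are fewer than `d` vertices, the missing columns are zero. -/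
def IsASE {V : Type*} [Fintype V] [DecidableEq V] {d : ℕ} (A : Matrix V V ℝ)
    (Xhat : V → EuclideanSpace ℝ (Fin d)) : Prop :=
  ∃ (B : Matrix V V ℝ)
    (u : OrthonormalBasis (Fin (Fintype.card V)) ℝ (EuclideanSpace ℝ V))
    (lam : Fin (Fintype.card V) → ℝ),
    B.PosSemidef ∧ B * B = A.transpose * A ∧ Antitone lam ∧
    (∀ k, Matrix.toEuclideanLin B (u k) = lam k • u k) ∧
    ∀ v a, Xhat v a =
      if h : (a : ℕ) < Fintype.card V then u ⟨a, h⟩ v * Real.sqrt (lam ⟨a, h⟩) else 0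

/-- Step `i` of the construction of the seeds. The `R` seeds are recorded by the vertices whose
rows of `Xhat` they are. A pair `y ≠ z` of seeds with maximal inner product is chosen; if no seed
has inner product with row `i` above that maximum, `z` is replaced by row `i`; if some seed has
inner product above it, nothing happens; in case of equality either may happen. -/
def SeedStep {R n D : ℕ} (Xhat : Fin n → EuclideanSpace ℝ (Fin D)) (i : Fin n)
    (s s' : Fin R → Fin n) : Prop :=
  ∃ y z : Fin R, y ≠ z ∧
    (∀ y' z' : Fin R, y' ≠ z' →
      inner ℝ (Xhat (s y')) (Xhat (s z')) ≤ inner ℝ (Xhat (s y)) (Xhat (s z))) ∧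
    (((∀ j, inner ℝ (Xhat i) (Xhat (s j)) ≤ inner ℝ (Xhat (s y)) (Xhat (s z))) ∧
        s' = Function.update s z i) ∨
      ((∃ j, inner ℝ (Xhat (s y)) (Xhat (s z)) ≤ inner ℝ (Xhat i) (Xhat (s j))) ∧
        s' = s))

/-- The `r`-th cluster: the seed `s r` together with all vertices assigned to it. -/
def cluster {R n : ℕ} (s : Fin R → Fin n) (τ : Fin n → Fin R) (r : Fin R) : Finset (Fin n) :=
  insert (s r) (Finset.univ.filter fun i => τ i = r)

/-- The statistic `T_{n,m}(X, Y)` for the points `X i`, `i ∈ H`, and `Y k`, `k ∈ H'`, with the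
radial kernel `κ(x, y) = φ(‖x - y‖)`; here `n = |H|` and `m = |H'|`. -/
noncomputable def testStatistic {V E : Type*} [DecidableEq V] [NormedAddCommGroup E]
    (φ : ℝ → ℝ) (H : Finset V) (X : V → E) (H' : Finset V) (Y : V → E) : ℝ :=
  1 / ((H.card : ℝ) * ((H.card : ℝ) - 1)) *
      (∑ i ∈ H, ∑ j ∈ H.erase i, φ ‖X i - X j‖)
    - 2 / ((H'.card : ℝ) * (H.card : ℝ)) * (∑ i ∈ H, ∑ k ∈ H', φ ‖X i - Y k‖)
    + 1 / ((H'.card : ℝ) * ((H'.card : ℝ) - 1)) *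
      (∑ k ∈ H', ∑ l ∈ H'.erase k, φ ‖Y k - Y l‖)

/-- The adjacency matrix of a graph. -/
noncomputable def adjacency {n : ℕ} (G : SimpleGraph (Fin n)) : Matrix (Fin n) (Fin n) ℝ :=
  open Classical in G.adjMatrix ℝ

/-- A run of the hierarchical structure detection algorithm (one level) on the graph `G`, with
all the choices it makes: the spectral embedding `Xhat` into `ℝ^{Rd}`, the successive seed
families (starting from any sample of `R` rows), the assignment of every vertex to a seed with
maximal inner product, and the spectral embeddings `XhatSub r` into `ℝᵈ` of the subgraphs induced
by the clusters (only the values of `XhatSub r` on the `r`-th cluster matter). -/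
structure AlgorithmRun (R d : ℕ) {n : ℕ} (G : SimpleGraph (Fin n)) where
  Xhat : Fin n → EuclideanSpace ℝ (Fin (R * d))
  seeds : Fin (n + 1) → Fin R → Fin n
  τhat : Fin n → Fin R
  XhatSub : Fin R → Fin n → EuclideanSpace ℝ (Fin d)
  isASE : IsASE (adjacency G) Xhat
  seedStep : ∀ i : Fin n, SeedStep Xhat i (seeds i.castSucc) (seeds i.succ)
  argmax : ∀ i j, inner ℝ (Xhat i) (Xhat (seeds (Fin.last n) j)) ≤
    inner ℝ (Xhat i) (Xhat (seeds (Fin.last n) (τhat i)))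
  isASE_sub : ∀ r, IsASE
    ((adjacency G).submatrix
      (fun v : {i // i ∈ cluster (seeds (Fin.last n)) τhat r} => (v : Fin n))
      (fun v : {i // i ∈ cluster (seeds (Fin.last n)) τhat r} => (v : Fin n)))
    (fun v : {i // i ∈ cluster (seeds (Fin.last n)) τhat r} => XhatSub r v)

/-- The estimated subgraph `Ĥ_r`, as a vertex set. -/
def AlgorithmRun.Hhat {R d n : ℕ} {G : SimpleGraph (Fin n)} (run : AlgorithmRun R d G)
    (r : Fin R) : Finset (Fin n) :=
  cluster (run.seeds (Fin.last n)) run.τhat r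

/-- The estimated dissimilarity matrix `Ŝ`. -/
noncomputable def AlgorithmRun.Shat {R d n : ℕ} {G : SimpleGraph (Fin n)}
    (run : AlgorithmRun R d G) (φ : ℝ → ℝ) : Matrix (Fin R) (Fin R) ℝ :=
  Matrix.of fun r s =>
    testStatistic φ (run.Hhat r) (run.XhatSub r) (run.Hhat s) (run.XhatSub s)

end Algorithm

section Latent

/-- `Y` gives `d`-dimensional latent positions of the subgraph on `H`, i.e. it reproduces the edge
probabilities `⟨X i, X j⟩`. Such a `Y` is determined up to an orthogonal transformation. -/
def IsLatentOn {V ι : Type*} [Fintype ι] {d : ℕ} (H : Finset V) (X : V → EuclideanSpace ℝ ι)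
    (Y : V → EuclideanSpace ℝ (Fin d)) : Prop :=
  ∀ i ∈ H, ∀ j ∈ H, inner ℝ (Y i) (Y j) = inner ℝ (X i) (X j)

/-- Among the `d`-dimensional latent positions of the subgraph on `H`, which are determined only
up to an orthogonal transformation, `Y` is a representative closest to `Xhat` in Frobenius norm
(orthogonal Procrustes alignment). -/
def IsAlignedLatent {V ι : Type*} [Fintype ι] {d : ℕ} (H : Finset V)
    (X : V → EuclideanSpace ℝ ι) (Xhat Y : V → EuclideanSpace ℝ (Fin d)) : Prop :=
  IsLatentOn H X Y ∧ ∀ Y' : V → EuclideanSpace ℝ (Fin d), IsLatentOn H X Y' →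
    ∑ i ∈ H, ‖Xhat i - Y i‖ ^ 2 ≤ ∑ i ∈ H, ‖Xhat i - Y' i‖ ^ 2

/-- The dissimilarity matrix `S` of the subgraphs on `H r` with latent positions `Y r`. -/
noncomputable def dissimilarity {R n d : ℕ} (φ : ℝ → ℝ) (H : Fin R → Finset (Fin n))
    (Y : Fin R → Fin n → EuclideanSpace ℝ (Fin d)) : Matrix (Fin R) (Fin R) ℝ :=
  Matrix.of fun r s => testStatistic φ (H r) (Y r) (H s) (Y s)

end Latent

section WellDefined

/-- Every real matrix has an adjacency spectral embedding. -/
theorem IsASE.exists {V : Type*} [Fintype V] [DecidableEq V] (d : ℕ) (A : Matrix V V ℝ) :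
    ∃ Xhat : V → EuclideanSpace ℝ (Fin d), IsASE A Xhat := by
  classical
  have hA : (A.transpose * A).PosSemidef := by
    have := Matrix.posSemidef_conjTranspose_mul_self A
    simpa [Matrix.conjTranspose_eq_transpose_of_trivial] using this
  obtain ⟨B, hB, hBB⟩ : ∃ B : Matrix V V ℝ, B.PosSemidef ∧ B * B = A.transpose * A := by
    open scoped MatrixOrder Matrix.Norms.L2Operator in
    refine ⟨CFC.sqrt (A.transpose * A), ?_, ?_⟩
    · exact Matrix.nonneg_iff_posSemidef.1 (CFC.sqrt_nonneg _)
    · exact CFC.sqrt_mul_sqrt_self _ (Matrix.nonneg_iff_posSemidef.2 hA)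
  refine ⟨fun v => WithLp.toLp 2 fun a => if h : (a : ℕ) < Fintype.card V then
    (hB.1.eigenvectorBasis.reindex
      ((Fintype.equivOfCardEq (Fintype.card_fin _)).symm)) ⟨a, h⟩ v *
      Real.sqrt (hB.1.eigenvalues₀ ⟨a, h⟩) else 0, B, _, hB.1.eigenvalues₀, hB, hBB,
    hB.1.eigenvalues₀_antitone, ?_, fun v a => rfl⟩
  intro k
  have h := hB.1.mulVec_eigenvectorBasis ((Fintype.equivOfCardEq (Fintype.card_fin _)) k)
  simp only [OrthonormalBasis.reindex_apply, Equiv.symm_symm]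
  ext i
  have h' := congrFun h i
  simpa [Matrix.toEuclideanLin, Matrix.IsHermitian.eigenvalues] using h'

/-- A seed step is always possible. -/
theorem SeedStep.exists {R n D : ℕ} (hR : 2 ≤ R) (Xhat : Fin n → EuclideanSpace ℝ (Fin D))
    (i : Fin n) (s : Fin R → Fin n) : ∃ s', SeedStep Xhat i s s' := by
  classical
  have hne : (Finset.univ.filter fun p : Fin R × Fin R => p.1 ≠ p.2).Nonempty :=
    ⟨(⟨0, by omega⟩, ⟨1, by omega⟩), by simp⟩
  obtain ⟨p, hp, hmax⟩ := Finset.exists_max_image _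
    (fun p : Fin R × Fin R => inner ℝ (Xhat (s p.1)) (Xhat (s p.2))) hne
  have hp' : p.1 ≠ p.2 := by simpa using hp
  have hm : ∀ y' z' : Fin R, y' ≠ z' →
      inner ℝ (Xhat (s y')) (Xhat (s z')) ≤ inner ℝ (Xhat (s p.1)) (Xhat (s p.2)) :=
    fun y' z' h => hmax (y', z') (by simpa using h)
  by_cases h : ∀ j, inner ℝ (Xhat i) (Xhat (s j)) ≤ inner ℝ (Xhat (s p.1)) (Xhat (s p.2))
  · exact ⟨_, p.1, p.2, hp', hm, Or.inl ⟨h, rfl⟩⟩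
  · push Not at h
    obtain ⟨j, hj⟩ := h
    exact ⟨s, p.1, p.2, hp', hm, Or.inr ⟨⟨j, hj.le⟩, rfl⟩⟩

/-- The algorithm always has a run. -/
theorem AlgorithmRun.nonempty {R d n : ℕ} (hR : 2 ≤ R) (hn : 0 < n) (G : SimpleGraph (Fin n)) :
    Nonempty (AlgorithmRun R d G) := by
  classical
  have : NeZero R := ⟨by omega⟩
  obtain ⟨Xhat, hX⟩ := IsASE.exists (R * d) (adjacency G)
  choose f hf using SeedStep.exists (n := n) hR Xhat
  let S : Fin (n + 1) → Fin R → Fin n :=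
    fun k => Fin.induction (motive := fun _ => Fin R → Fin n) (fun _ => ⟨0, hn⟩)
      (fun i s => f i s) k
  have hS : ∀ i : Fin n, SeedStep Xhat i (S i.castSucc) (S i.succ) := fun i => by
    have : S i.succ = f i (S i.castSucc) := by simp [S]
    rw [this]; exact hf _ _
  have hτ : ∀ i, ∃ t, ∀ j, inner ℝ (Xhat i) (Xhat (S (Fin.last n) j)) ≤
      inner ℝ (Xhat i) (Xhat (S (Fin.last n) t)) := fun i => by
    obtain ⟨t, -, ht⟩ := Finset.exists_max_image (Finset.univ : Finset (Fin R))
      (fun j => inner ℝ (Xhat i) (Xhat (S (Fin.last n) j))) ⟨0, by simp⟩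
    exact ⟨t, fun j => ht j (by simp)⟩
  choose τ hτ using hτ
  have hsub : ∀ r, ∃ Y : Fin n → EuclideanSpace ℝ (Fin d), IsASE ((adjacency G).submatrix
      (fun v : {i // i ∈ cluster (S (Fin.last n)) τ r} => (v : Fin n))
      (fun v : {i // i ∈ cluster (S (Fin.last n)) τ r} => (v : Fin n)))
      (fun v : {i // i ∈ cluster (S (Fin.last n)) τ r} => Y v) := fun r => by
    obtain ⟨Y, hY⟩ := IsASE.exists d ((adjacency G).submatrix
      (fun v : {i // i ∈ cluster (S (Fin.last n)) τ r} => (v : Fin n))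
      (fun v : {i // i ∈ cluster (S (Fin.last n)) τ r} => (v : Fin n)))
    refine ⟨fun i => if h : i ∈ cluster (S (Fin.last n)) τ r then Y ⟨i, h⟩ else 0, ?_⟩
    convert hY using 1
    ext v
    simp
  choose Y hY using hsub
  exact ⟨⟨Xhat, S, τ, Y, hX, hS, hτ, hY⟩⟩

/-- An aligned representative exists as soon as there are `d`-dimensional latent positions. -/
theorem IsAlignedLatent.exists {V ι : Type*} [Fintype V] [Fintype ι] {d : ℕ} (H : Finset V)
    (X : V → EuclideanSpace ℝ ι) (Xhat : V → EuclideanSpace ℝ (Fin d))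
    (h : ∃ Y : V → EuclideanSpace ℝ (Fin d), IsLatentOn H X Y) :
    ∃ Y, IsAlignedLatent H X Xhat Y := by
  classical
  obtain ⟨Y₀, h₀⟩ := h
  let C : Set (V → EuclideanSpace ℝ (Fin d)) :=
    {Y | IsLatentOn H X Y ∧ ∀ i ∉ H, Y i = 0}
  have hC : IsCompact C := by
    refine Metric.isCompact_of_isClosed_isBounded ?_ ?_
    · have : C = (⋂ i ∈ H, ⋂ j ∈ H, {Y : V → EuclideanSpace ℝ (Fin d) |
          inner ℝ (Y i) (Y j) = inner ℝ (X i) (X j)}) ∩ ⋂ i, ⋂ (_ : i ∉ H), {Y | Y i = 0} := by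
        ext Y; simp [C, IsLatentOn]
      rw [this]
      refine IsClosed.inter (isClosed_biInter fun i _ => isClosed_biInter fun j _ => ?_)
        (isClosed_iInter fun i => isClosed_iInter fun _ => ?_)
      · exact isClosed_eq (by fun_prop) (by fun_prop)
      · exact isClosed_eq (by fun_prop) (by fun_prop)
    · refine (Metric.isBounded_closedBall (x := 0) (r := ∑ i, ‖X i‖)).subset ?_
      intro Y hY
      rw [mem_closedBall_zero_iff, pi_norm_le_iff_of_nonneg (by positivity)]
      intro i
      by_cases hi : i ∈ H
      · have := hY.1 i hi i hi
        rw [real_inner_self_eq_norm_sq, real_inner_self_eq_norm_sq] at this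
        have e : ‖Y i‖ = ‖X i‖ := by
          exact (sq_eq_sq₀ (norm_nonneg _) (norm_nonneg _)).1 this
        rw [e]
        exact Finset.single_le_sum (f := fun i => ‖X i‖) (fun _ _ => norm_nonneg _)
          (Finset.mem_univ i)
      · rw [hY.2 i hi, norm_zero]; positivity
  have cut : ∀ Y : V → EuclideanSpace ℝ (Fin d), IsLatentOn H X Y →
      (fun i => if i ∈ H then Y i else 0) ∈ C := fun Y hY =>
    ⟨fun i hi j hj => by simpa [hi, hj] using hY i hi j hj, fun i hi => by simp [hi]⟩
  obtain ⟨Y, hY, hmin⟩ := hC.exists_isMinOn ⟨_, cut Y₀ h₀⟩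
    (f := fun Y => ∑ i ∈ H, ‖Xhat i - Y i‖ ^ 2) (by fun_prop)
  refine ⟨Y, hY.1, fun Y' h' => ?_⟩
  refine (hmin (cut Y' h')).trans (le_of_eq ?_)
  exact Finset.sum_congr rfl fun i hi => by simp [hi]

end WellDefined

/-! The matrix `A` is the Gram matrix `Q Q*` of the latent positions (the rows of `Q`) plus noise.
By Hoeffding's inequality and a union bound, outside an event of probability exponentially small
in `n`, the noise averages out in products of two different columns and over all vertices with a
given latent position. Hence, with `ε = o(n)`, the noise has operator norm at most `ε`, and the
entries of its product with `Q` are at most `ε`. The nonzero eigenvalues of `Q Q*` are of order `n`,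
since the atoms span the space and each is taken by a positive proportion of the vertices.

Let `P` be the Moore-Penrose inverse of `Q`, and let `T` invert `|A|` on its leading singular
vectors. As `A` is bounded below by `-ε`, it agrees with `|A|` on these vectors, so the inner
products of the embedding are `⟨T A eᵢ, A eⱼ⟩`. An identity of Wedin type gives
`‖T - P* P‖ = O(ε / n²)`, while `‖A eᵢ‖ ≤ √n` and `P A eᵢ` is close to the `i`-th latent position.
So the inner products are recovered uniformly in the two vertices, without any alignment of the
embedding with the latent positions.

Uniform recovery settles the clustering: up to a small error, inner products are at least `q` inside
the classes and at most `p` between them, so the seed process never loses a class and visits all of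
them. For the dissimilarities, the ranks of the blocks add up to at least `R d`, so that each block
spans exactly `d` dimensions and the same estimate applies to its subgraph. The Gram map on finitely
many vectors is proper and continuous, so families with close Gram matrices are close after an
isometry; the aligned latent positions are then close to the embedding, and uniform continuity of
the kernel on bounded sets concludes.
-/

section MoorePenrose

variable {F H : Type*} [NormedAddCommGroup F] [InnerProductSpace ℝ F]
  [NormedAddCommGroup H] [InnerProductSpace ℝ H] [CompleteSpace H]

open ContinuousLinearMap (adjoint)

/-- `P` is the Moore-Penrose inverse of the operator `Q`, which is injective with closed range:
a left inverse for which `Q P` is an orthogonal projection. -/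
structure IsMoorePenroseInverse (Q : F →L[ℝ] H) (P : H →L[ℝ] F) : Prop where
  left_inv : P ∘L Q = 1
  adjoint_comp : adjoint (Q ∘L P) = Q ∘L P

namespace IsMoorePenroseInverse

variable {Q : F →L[ℝ] H} {P : H →L[ℝ] F} {ρ : ℝ}

theorem apply_apply (h : IsMoorePenroseInverse Q P) (v : F) : P (Q v) = v :=
  DFunLike.congr_fun h.left_inv v

theorem isStarProjection (h : IsMoorePenroseInverse Q P) : IsStarProjection (Q ∘L P) where
  isIdempotentElem := by
    ext x
    simp [h.apply_apply]
  isSelfAdjoint := h.adjoint_comp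

theorem norm_one_sub_le (h : IsMoorePenroseInverse Q P) : ‖1 - Q ∘L P‖ ≤ 1 :=
  h.isStarProjection.one_sub.norm_le

variable [CompleteSpace F]

theorem adjoint_comp_adjoint (h : IsMoorePenroseInverse Q P) : adjoint P ∘L adjoint Q = Q ∘L P := by
  rw [← ContinuousLinearMap.adjoint_comp, h.adjoint_comp]

theorem adjoint_comp_comp (h : IsMoorePenroseInverse Q P) : adjoint Q ∘L (Q ∘L P) = adjoint Q := by
  rw [← h.adjoint_comp, ← ContinuousLinearMap.adjoint_comp, ContinuousLinearMap.comp_assoc,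
    h.left_inv]
  rfl

theorem comp_comp_adjoint (h : IsMoorePenroseInverse Q P) : (Q ∘L P) ∘L adjoint P = adjoint P := by
  rw [← h.adjoint_comp, ← ContinuousLinearMap.adjoint_comp, ← ContinuousLinearMap.comp_assoc,
    h.left_inv]
  rfl

theorem gram_mul (h : IsMoorePenroseInverse Q P) :
    (Q ∘L adjoint Q) * (adjoint P ∘L P) = Q ∘L P := by
  have hQP : adjoint Q ∘L adjoint P = 1 := by
    rw [← ContinuousLinearMap.adjoint_comp, h.left_inv]
    exact ContinuousLinearMap.adjoint_id
  ext x
  simpa using congrArg Q (DFunLike.congr_fun hQP (P x))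

theorem mul_gram (h : IsMoorePenroseInverse Q P) :
    (adjoint P ∘L P) * (Q ∘L adjoint Q) = Q ∘L P := by
  ext x
  simpa [h.apply_apply] using DFunLike.congr_fun h.adjoint_comp_adjoint x

theorem gram_mul_gram_mul (h : IsMoorePenroseInverse Q P) :
    (Q ∘L adjoint Q) * (Q ∘L adjoint Q) * (adjoint P ∘L P) = Q ∘L adjoint Q := by
  rw [mul_assoc, h.gram_mul]
  ext x
  simpa using congrArg Q (DFunLike.congr_fun h.adjoint_comp_comp x)

theorem gram_mul_mul_self (h : IsMoorePenroseInverse Q P) :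
    (Q ∘L adjoint Q) * (adjoint P ∘L P) * (adjoint P ∘L P) = adjoint P ∘L P := by
  rw [h.gram_mul]
  ext x
  simpa using DFunLike.congr_fun h.comp_comp_adjoint (P x)

theorem mul_norm_apply_le (h : IsMoorePenroseInverse Q P) (hQ : ∀ v, ρ * ‖v‖ ^ 2 ≤ ‖Q v‖ ^ 2)
    (x : H) : ρ * ‖P x‖ ≤ ‖adjoint Q x‖ := by
  rcases (norm_nonneg (P x)).eq_or_lt with h0 | hpos
  · rw [← h0, mul_zero]
    exact norm_nonneg _
  refine le_of_mul_le_mul_right ?_ hpos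
  calc ρ * ‖P x‖ * ‖P x‖ = ρ * ‖P x‖ ^ 2 := by ring
    _ ≤ ‖Q (P x)‖ ^ 2 := hQ _
    _ = inner ℝ (adjoint Q (Q (P x))) (P x) := by
      rw [Q.adjoint_inner_left, real_inner_self_eq_norm_sq]
    _ = inner ℝ (adjoint Q x) (P x) := by
      rw [← DFunLike.congr_fun h.adjoint_comp_comp x]
      rfl
    _ ≤ ‖adjoint Q x‖ * ‖P x‖ := real_inner_le_norm _ _

theorem norm_adjoint_comp_self_le (h : IsMoorePenroseInverse Q P) (hρ : 0 < ρ)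
    (hQ : ∀ v, ρ * ‖v‖ ^ 2 ≤ ‖Q v‖ ^ 2) : ‖adjoint P ∘L P‖ ≤ 1 / ρ := by
  have hP : ‖P‖ ≤ Real.sqrt (1 / ρ) := by
    refine P.opNorm_le_bound (Real.sqrt_nonneg _) fun x => ?_
    rw [← sq_le_sq₀ (norm_nonneg _) (by positivity), mul_pow, Real.sq_sqrt (by positivity),
      one_div_mul_eq_div, le_div_iff₀' hρ]
    calc ρ * ‖P x‖ ^ 2 ≤ ‖(Q ∘L P) x‖ ^ 2 := hQ _
      _ ≤ ‖x‖ ^ 2 := by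
        gcongr
        exact (Q ∘L P).le_of_opNorm_le h.isStarProjection.norm_le x |>.trans_eq (one_mul _)
  rw [ContinuousLinearMap.norm_adjoint_comp_self, ← sq]
  exact (pow_le_pow_left₀ (norm_nonneg _) hP 2).trans_eq (Real.sq_sqrt (by positivity))

end IsMoorePenroseInverse

theorem exists_isMoorePenroseInverse [CompleteSpace F] {Q : F →L[ℝ] H} {ρ : ℝ} (hρ : 0 < ρ)
    (hQ : ∀ v, ρ * ‖v‖ ^ 2 ≤ ‖Q v‖ ^ 2) : ∃ P, IsMoorePenroseInverse Q P := by
  have hcoercive : IsCoercive ((innerSL ℝ).bilinearComp Q Q) :=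
    ⟨ρ, hρ, fun v => by simpa [mul_assoc, ← sq] using hQ v⟩
  set S := hcoercive.continuousLinearEquivOfBilin
  have hS : ∀ v, S v = adjoint Q (Q v) := fun v => ext_inner_right ℝ fun w => by
    rw [hcoercive.continuousLinearEquivOfBilin_apply, ContinuousLinearMap.adjoint_inner_left]
    rfl
  refine ⟨(S.symm : F →L[ℝ] F) ∘L adjoint Q, ?_, ?_⟩
  · ext v
    simp [← hS]
  · rw [eq_comm, ContinuousLinearMap.eq_adjoint_iff]
    have hinner : ∀ h k : H,
        inner ℝ (Q (S.symm (adjoint Q h))) k =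
          inner ℝ (Q (S.symm (adjoint Q h))) (Q (S.symm (adjoint Q k))) := fun h k => by
        rw [← Q.adjoint_inner_right, ← Q.adjoint_inner_right, ← hS, S.apply_symm_apply]
    intro h k
    simp only [ContinuousLinearMap.comp_apply, ContinuousLinearEquiv.coe_coe]
    rw [hinner, real_inner_comm, ← hinner, real_inner_comm]

end MoorePenrose

section SingularBasis

variable {H : Type*} [NormedAddCommGroup H] [InnerProductSpace ℝ H] {N : ℕ}

theorem norm_sq_eq_sum_inner_sq {ι : Type*} [Fintype ι] (u : OrthonormalBasis ι ℝ H) (x : H) :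
    ‖x‖ ^ 2 = ∑ k, inner ℝ (u k) x ^ 2 := by
  simp [← u.sum_sq_norm_inner_right x]

/-- The operator which is diagonal in the orthonormal basis `u`, with diagonal entries `f`. -/
noncomputable def diagonalOperator (u : OrthonormalBasis (Fin N) ℝ H) (f : Fin N → ℝ) :
    H →L[ℝ] H :=
  ∑ k, f k • InnerProductSpace.rankOne ℝ (u k) (u k)

theorem diagonalOperator_apply (u : OrthonormalBasis (Fin N) ℝ H) (f : Fin N → ℝ) (x : H) :
    diagonalOperator u f x = ∑ k, (f k * inner ℝ (u k) x) • u k := by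
  simp [diagonalOperator, smul_smul]

theorem inner_diagonalOperator (u : OrthonormalBasis (Fin N) ℝ H) (f : Fin N → ℝ) (k : Fin N)
    (x : H) : inner ℝ (u k) (diagonalOperator u f x) = f k * inner ℝ (u k) x := by
  rw [diagonalOperator_apply, u.orthonormal.inner_right_fintype]

theorem diagonalOperator_mul (u : OrthonormalBasis (Fin N) ℝ H) (f g : Fin N → ℝ) :
    diagonalOperator u f * diagonalOperator u g = diagonalOperator u (f * g) := by
  ext x
  refine InnerProductSpace.ext_inner_left_basis u.toBasis fun k => ?_
  simp [mul_apply_eq_comp, inner_diagonalOperator, mul_assoc]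

theorem one_sub_diagonalOperator (u : OrthonormalBasis (Fin N) ℝ H) (f : Fin N → ℝ) :
    1 - diagonalOperator u f = diagonalOperator u (1 - f) := by
  ext x
  refine InnerProductSpace.ext_inner_left_basis u.toBasis fun k => ?_
  simp [inner_diagonalOperator, inner_sub_right, sub_mul]

theorem isSelfAdjoint_diagonalOperator [CompleteSpace H] (u : OrthonormalBasis (Fin N) ℝ H)
    (f : Fin N → ℝ) : IsSelfAdjoint (diagonalOperator u f) := by
  rw [ContinuousLinearMap.isSelfAdjoint_iff_isSymmetric]
  intro x y
  simp only [ContinuousLinearMap.coe_coe, diagonalOperator_apply, sum_inner, inner_sum,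
    real_inner_smul_left, real_inner_smul_right, real_inner_comm x]
  exact Finset.sum_congr rfl fun k _ => by ring

theorem norm_diagonalOperator_le (u : OrthonormalBasis (Fin N) ℝ H) {f : Fin N → ℝ} {C : ℝ}
    (hC : 0 ≤ C) (hf : ∀ k, |f k| ≤ C) : ‖diagonalOperator u f‖ ≤ C := by
  refine ContinuousLinearMap.opNorm_le_bound _ hC fun x => ?_
  rw [← sq_le_sq₀ (norm_nonneg _) (by positivity), mul_pow, norm_sq_eq_sum_inner_sq u,
    norm_sq_eq_sum_inner_sq u x, Finset.mul_sum]
  gcongr with k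
  rw [inner_diagonalOperator, mul_pow]
  exact mul_le_mul_of_nonneg_right (sq_le_sq' (abs_le.1 (hf k)).1 (abs_le.1 (hf k)).2)
    (sq_nonneg _)

theorem exists_mem_ne_zero_of_card_lt_finrank (u : OrthonormalBasis (Fin N) ℝ H)
    {W : Submodule ℝ H} {s : Finset (Fin N)} (hs : s.card < Module.finrank ℝ W) :
    ∃ w ∈ W, w ≠ 0 ∧ ∀ k ∈ s, inner ℝ (u k) w = (0 : ℝ) := by
  have : FiniteDimensional ℝ H := u.toBasis.finiteDimensional_of_finite
  let f : W →ₗ[ℝ] s → ℝ := LinearMap.pi fun k => (innerₛₗ ℝ (u k)) ∘ₗ W.subtype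
  have hker : LinearMap.ker f ≠ ⊥ := LinearMap.ker_ne_bot_of_finrank_lt (by simpa using hs)
  obtain ⟨w, hw, hw0⟩ := Submodule.exists_mem_ne_zero_of_ne_bot hker
  exact ⟨w, w.2, by simpa using hw0, fun k hk => congrFun hw ⟨k, hk⟩⟩

/-- Spectral data of `|A|` for a symmetric operator `A`: the orthonormal basis `u` consists of
eigenvectors of `|A|`, for the eigenvalues `lam` in decreasing order. This is encoded through
`A ^ 2`, so that `|A|` need not be mentioned. -/
structure IsSingularBasis (A : H →L[ℝ] H) (u : OrthonormalBasis (Fin N) ℝ H)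
    (lam : Fin N → ℝ) : Prop where
  inner_apply_left : ∀ x y, inner ℝ (A x) y = inner ℝ x (A y)
  antitone : Antitone lam
  nonneg : ∀ k, 0 ≤ lam k
  apply_apply : ∀ k, A (A (u k)) = lam k ^ 2 • u k

namespace IsSingularBasis

variable {A : H →L[ℝ] H} {u : OrthonormalBasis (Fin N) ℝ H} {lam : Fin N → ℝ}

theorem norm_apply_sq (h : IsSingularBasis A u lam) (x : H) :
    ‖A x‖ ^ 2 = ∑ k, lam k ^ 2 * inner ℝ (u k) x ^ 2 := by
  rw [← real_inner_self_eq_norm_sq, h.inner_apply_left, ← u.sum_inner_mul_inner]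
  refine Finset.sum_congr rfl fun k _ => ?_
  rw [← h.inner_apply_left, ← h.inner_apply_left, h.apply_apply, real_inner_smul_left,
    real_inner_comm]
  ring

theorem le_of_forall_mul_norm_le (h : IsSingularBasis A u lam) {W : Submodule ℝ H} {c : ℝ}
    (hW : ∀ w ∈ W, c * ‖w‖ ≤ ‖A w‖) {k : Fin N} (hk : k < Module.finrank ℝ W) : c ≤ lam k := by
  obtain ⟨w, hwW, hw0, hw⟩ := exists_mem_ne_zero_of_card_lt_finrank u (W := W)
    (s := Finset.Iio k) (by simpa using hk)
  have hupper : ‖A w‖ ^ 2 ≤ (lam k * ‖w‖) ^ 2 := by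
    rw [h.norm_apply_sq, mul_pow, norm_sq_eq_sum_inner_sq u w, Finset.mul_sum]
    refine Finset.sum_le_sum fun i _ => ?_
    rcases lt_or_ge i k with hik | hki
    · simp [hw i (Finset.mem_Iio.2 hik)]
    · gcongr
      exacts [h.nonneg i, h.antitone hki]
  have hwpos : 0 < ‖w‖ := norm_pos_iff.2 hw0
  have hle := (sq_le_sq₀ (norm_nonneg _) (mul_nonneg (h.nonneg k) hwpos.le)).1 hupper
  exact le_of_mul_le_mul_right ((hW w hwW).trans hle) hwpos

theorem le_of_forall_norm_le_mul (h : IsSingularBasis A u lam) {W : Submodule ℝ H} {c : ℝ}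
    (hW : ∀ w ∈ W, ‖A w‖ ≤ c * ‖w‖) {k : Fin N}
    (hk : N ≤ k + Module.finrank ℝ W) : lam k ≤ c := by
  obtain ⟨w, hwW, hw0, hw⟩ := exists_mem_ne_zero_of_card_lt_finrank u (W := W)
    (s := Finset.Ioi k) (by simp; omega)
  have hlower : (lam k * ‖w‖) ^ 2 ≤ ‖A w‖ ^ 2 := by
    rw [h.norm_apply_sq, mul_pow, norm_sq_eq_sum_inner_sq u w, Finset.mul_sum]
    refine Finset.sum_le_sum fun i _ => ?_
    rcases le_or_gt i k with hik | hki
    · gcongr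
      exacts [h.nonneg k, h.antitone hik]
    · simp [hw i (Finset.mem_Ioi.2 hki)]
  have hle := (sq_le_sq₀ (mul_nonneg (h.nonneg k) (norm_nonneg w)) (norm_nonneg _)).1 hlower
  exact le_of_mul_le_mul_right (hle.trans (hW w hwW)) (norm_pos_iff.2 hw0)

theorem apply_eq_smul (h : IsSingularBasis A u lam) {ε : ℝ}
    (hε : ∀ x, -(ε * ‖x‖ ^ 2) ≤ inner ℝ (A x) x) {k : Fin N} (hk : ε < lam k) :
    A (u k) = lam k • u k := by
  set z := A (u k) - lam k • u k with hz
  have hAz : A z = -(lam k • z) := by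
    rw [hz, map_sub, map_smul, h.apply_apply, smul_sub, smul_smul, sq]
    abel
  have hnorm : -(ε * ‖z‖ ^ 2) ≤ -(lam k * ‖z‖ ^ 2) := by
    refine (hε z).trans_eq ?_
    rw [hAz, inner_neg_left, real_inner_smul_left, real_inner_self_eq_norm_sq]
  have hz0 : ‖z‖ ^ 2 = 0 := by nlinarith [sq_nonneg ‖z‖]
  exact sub_eq_zero.1 (by simpa using hz0)

end IsSingularBasis

end SingularBasis

section Wedin

open ContinuousLinearMap (adjoint)

theorem norm_sub_le_of_approx_inverse {𝔸 : Type*} [NormedRing 𝔸] {a b x y : 𝔸} {ρ ε : ℝ}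
    (hρ : 0 < ρ) (hx : ‖x‖ ≤ 2 / ρ) (hy : ‖y‖ ≤ 1 / ρ) (hab : ‖a - b‖ ≤ ε)
    (hxxa : x * x * a = x) (hbby : b * b * y = b) (hbyy : b * y * y = y)
    (hxa : ‖1 - x * a‖ ≤ 1) (hxaa : ‖(1 - x * a) * a‖ ≤ ε) (hby : ‖1 - b * y‖ ≤ 1) :
    ‖x - y‖ ≤ 8 * ε / ρ ^ 2 := by
  have hid : x - y = x * x * (a - b) * (1 - b * y) - x * (a - b) * y - (1 - x * a) * a * y * y +
      (1 - x * a) * (a - b) * y * y := by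
    have hleft : x * x * (a - b) * (1 - b * y) = x - x * b * y := by
      calc x * x * (a - b) * (1 - b * y)
          = x * x * a - x * x * b - x * x * a * b * y + x * x * (b * b * y) := by noncomm_ring
        _ = x - x * b * y := by rw [hxxa, hbby]; abel
    have hright : (1 - x * a) * a * y * y - (1 - x * a) * (a - b) * y * y = y - x * a * y := by
      calc (1 - x * a) * a * y * y - (1 - x * a) * (a - b) * y * y
          = b * y * y - x * a * (b * y * y) := by noncomm_ring
        _ = y - x * a * y := by rw [hbyy]
    rw [sub_add, hright, hleft]
    noncomm_ring
  have : 0 ≤ ε := (norm_nonneg _).trans hab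
  have h₁ : ‖x * x * (a - b) * (1 - b * y)‖ ≤ 2 / ρ * (2 / ρ) * ε * 1 := by
    refine norm_mul_le_of_le (norm_mul_le_of_le (norm_mul_le_of_le hx hx) hab) hby
  have h₂ : ‖x * (a - b) * y‖ ≤ 2 / ρ * ε * (1 / ρ) :=
    norm_mul_le_of_le (norm_mul_le_of_le hx hab) hy
  have h₃ : ‖(1 - x * a) * a * y * y‖ ≤ ε * (1 / ρ) * (1 / ρ) :=
    norm_mul_le_of_le (norm_mul_le_of_le hxaa hy) hy
  have h₄ : ‖(1 - x * a) * (a - b) * y * y‖ ≤ 1 * ε * (1 / ρ) * (1 / ρ) :=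
    norm_mul_le_of_le (norm_mul_le_of_le (norm_mul_le_of_le hxa hab) hy) hy
  calc ‖x - y‖ ≤ ‖x * x * (a - b) * (1 - b * y)‖ + ‖x * (a - b) * y‖ +
        ‖(1 - x * a) * a * y * y‖ + ‖(1 - x * a) * (a - b) * y * y‖ := by
        rw [hid]
        exact (norm_add_le _ _).trans (by grw [norm_sub_le, norm_sub_le])
    _ ≤ 2 / ρ * (2 / ρ) * ε * 1 + 2 / ρ * ε * (1 / ρ) + ε * (1 / ρ) * (1 / ρ) +
        1 * ε * (1 / ρ) * (1 / ρ) := by gcongr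
    _ = 8 * ε / ρ ^ 2 := by
      field_simp
      ring

theorem abs_inner_add_add_sub_inner_le {F : Type*} [NormedAddCommGroup F]
    [InnerProductSpace ℝ F] {a b w z : F} {c : ℝ} (ha : ‖a‖ ≤ 1)
    (hb : ‖b‖ ≤ 1) (hw : ‖w‖ ≤ c) (hz : ‖z‖ ≤ c) (hc : c ≤ 1) :
    |inner ℝ (a + w) (b + z) - inner ℝ a b| ≤ 3 * c := by
  have hexpand : inner ℝ (a + w) (b + z) - inner ℝ a b =
      inner ℝ a z + inner ℝ w b + inner ℝ w z := by
    simp only [inner_add_left, inner_add_right]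
    ring
  have haz := (abs_real_inner_le_norm a z).trans (mul_le_mul ha hz (norm_nonneg _) zero_le_one)
  have hwb := (abs_real_inner_le_norm w b).trans
    (mul_le_mul hw hb (norm_nonneg _) ((norm_nonneg _).trans hw))
  have hwz := (abs_real_inner_le_norm w z).trans
    (mul_le_mul (hw.trans hc) hz (norm_nonneg _) zero_le_one)
  rw [hexpand]
  linarith [abs_add_three (inner ℝ a z) (inner ℝ w b) (inner ℝ w z)]

variable {H : Type*} [NormedAddCommGroup H] [InnerProductSpace ℝ H] {N : ℕ}

/-- The inverse of `|A|` on the span of the first `m` vectors of a singular basis `u` of `A`,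
extended by zero to the other ones. -/
noncomputable def truncatedInverse (u : OrthonormalBasis (Fin N) ℝ H) (lam : Fin N → ℝ) (m : ℕ) :
    H →L[ℝ] H :=
  diagonalOperator u fun k => if k < m then (lam k)⁻¹ else 0

namespace IsSingularBasis

variable {A : H →L[ℝ] H} {u : OrthonormalBasis (Fin N) ℝ H} {lam : Fin N → ℝ} {m : ℕ}

theorem inner_apply_of_apply_eq_smul (h : IsSingularBasis A u lam) {k : Fin N}
    (hk : A (u k) = lam k • u k) (x : H) :
    inner ℝ (u k) (A x) = lam k * inner ℝ (u k) x := by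
  rw [← h.inner_apply_left, hk, real_inner_smul_left]

theorem truncatedInverse_mul (h : IsSingularBasis A u lam)
    (hpos : ∀ k : Fin N, k < m → 0 < lam k)
    (heigen : ∀ k : Fin N, k < m → A (u k) = lam k • u k) :
    truncatedInverse u lam m * A = diagonalOperator u fun k => if k < m then 1 else 0 := by
  ext x
  refine InnerProductSpace.ext_inner_left_basis u.toBasis fun k => ?_
  simp only [OrthonormalBasis.coe_toBasis, mul_apply_eq_comp, truncatedInverse,
    inner_diagonalOperator]
  split_ifs with hk
  · rw [h.inner_apply_of_apply_eq_smul (heigen k hk), inv_mul_cancel_left₀ (hpos k hk).ne',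
      one_mul]
  · simp

theorem inner_truncatedInverse_apply_apply (h : IsSingularBasis A u lam)
    (hpos : ∀ k : Fin N, k < m → 0 < lam k)
    (heigen : ∀ k : Fin N, k < m → A (u k) = lam k • u k) (x y : H) :
    inner ℝ (truncatedInverse u lam m (A x)) (A y) =
      ∑ k : Fin N, if k < m then lam k * (inner ℝ (u k) x * inner ℝ (u k) y) else 0 := by
  rw [← mul_apply_eq_comp, h.truncatedInverse_mul hpos heigen, diagonalOperator_apply, sum_inner]
  refine Finset.sum_congr rfl fun k _ => ?_
  split_ifs with hk
  · rw [real_inner_smul_left, h.inner_apply_of_apply_eq_smul (heigen k hk)]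
    ring
  · simp

theorem norm_one_sub_diagonalOperator_mul_le [CompleteSpace H] (h : IsSingularBasis A u lam)
    {ε : ℝ} (hε : 0 ≤ ε) (hsmall : ∀ k : Fin N, m ≤ k → lam k ≤ ε) :
    ‖(1 - diagonalOperator u fun k => if k < m then 1 else 0) * A‖ ≤ ε := by
  have hA : star A = A := ContinuousLinearMap.isSelfAdjoint_iff_isSymmetric.2 h.inner_apply_left
  rw [← norm_star, star_mul, hA, one_sub_diagonalOperator,
    (isSelfAdjoint_diagonalOperator u _).star_eq]
  refine ContinuousLinearMap.opNorm_le_bound _ hε fun x => ?_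
  rw [← sq_le_sq₀ (norm_nonneg _) (by positivity), mul_apply_eq_comp, h.norm_apply_sq, mul_pow,
    norm_sq_eq_sum_inner_sq u x, Finset.mul_sum]
  refine Finset.sum_le_sum fun k _ => ?_
  rw [inner_diagonalOperator]
  rcases lt_or_ge (k : ℕ) m with hk | hk
  · simp only [Pi.sub_apply, Pi.one_apply, hk, if_true]
    nlinarith [mul_nonneg (sq_nonneg ε) (sq_nonneg (inner ℝ (u k) x))]
  · simp only [Pi.sub_apply, Pi.one_apply, hk.not_gt, if_false, sub_zero, one_mul]
    gcongr
    exacts [h.nonneg k, hsmall k hk]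

end IsSingularBasis

section PerturbedGram

variable {F : Type*} [NormedAddCommGroup F] [InnerProductSpace ℝ F] [CompleteSpace F]
  [CompleteSpace H] {A : H →L[ℝ] H} {Q : F →L[ℝ] H} {P : H →L[ℝ] F}
  {u : OrthonormalBasis (Fin N) ℝ H} {lam : Fin N → ℝ} {ρ ε : ℝ}

theorem IsSingularBasis.sub_le_of_lt_finrank (h : IsSingularBasis A u lam)
    (hP : IsMoorePenroseInverse Q P) (hρ : 0 < ρ) (hQ : ∀ v, ρ * ‖v‖ ^ 2 ≤ ‖Q v‖ ^ 2)
    (hA : ‖A - Q ∘L adjoint Q‖ ≤ ε) {k : Fin N} (hk : k < Module.finrank ℝ F) :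
    ρ - ε ≤ lam k := by
  have hinj : Function.Injective Q := Function.LeftInverse.injective hP.apply_apply
  refine h.le_of_forall_mul_norm_le (W := Q.range) ?_ ?_
  · rintro _ ⟨v, rfl⟩
    have hw : ρ * ‖Q v‖ ≤ ‖(Q ∘L adjoint Q) (Q v)‖ := by
      have hproj : (adjoint P ∘L P) ((Q ∘L adjoint Q) (Q v)) = Q v := by
        rw [← mul_apply_eq_comp, hP.mul_gram, ContinuousLinearMap.comp_apply,
          hP.apply_apply]
      have := (adjoint P ∘L P).le_of_opNorm_le (hP.norm_adjoint_comp_self_le hρ hQ)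
        ((Q ∘L adjoint Q) (Q v))
      rwa [hproj, one_div_mul_eq_div, le_div_iff₀' hρ] at this
    have hE := (A - Q ∘L adjoint Q).le_of_opNorm_le hA (Q v)
    have htri := norm_sub_norm_le ((Q ∘L adjoint Q) (Q v)) (A (Q v))
    rw [norm_sub_rev, ← sub_apply] at htri
    change (ρ - ε) * ‖Q v‖ ≤ ‖A (Q v)‖
    linarith
  · rwa [LinearMap.finrank_range_of_inj hinj]

theorem IsSingularBasis.le_of_finrank_le (h : IsSingularBasis A u lam) [FiniteDimensional ℝ F]
    (hA : ‖A - Q ∘L adjoint Q‖ ≤ ε) {k : Fin N} (hk : Module.finrank ℝ F ≤ k) :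
    lam k ≤ ε := by
  have : FiniteDimensional ℝ H := u.toBasis.finiteDimensional_of_finite
  refine h.le_of_forall_norm_le_mul (W := (Q.range)ᗮ) ?_ ?_
  · intro w hw
    have hw0 : adjoint Q w = 0 := by rwa [Q.orthogonal_range] at hw
    simpa [hw0] using (A - Q ∘L adjoint Q).le_of_opNorm_le hA w
  · have hsum := (Q.range).finrank_add_finrank_orthogonal
    have hN : Module.finrank ℝ H = N := by simp [Module.finrank_eq_card_basis u.toBasis]
    have hrange := LinearMap.finrank_range_le (Q : F →ₗ[ℝ] H)
    change _ ≤ _ + Module.finrank ℝ (LinearMap.range (Q : F →ₗ[ℝ] H))ᗮ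
    omega

theorem neg_mul_norm_sq_le_inner (hA : ‖A - Q ∘L adjoint Q‖ ≤ ε) (x : H) :
    -(ε * ‖x‖ ^ 2) ≤ inner ℝ (A x) x := by
  have hsplit : inner ℝ (A x) x = ‖adjoint Q x‖ ^ 2 + inner ℝ ((A - Q ∘L adjoint Q) x) x := by
    rw [sub_apply, inner_sub_left, ContinuousLinearMap.comp_apply,
      ← ContinuousLinearMap.adjoint_inner_right Q, real_inner_self_eq_norm_sq]
    ring
  have hE : |inner ℝ ((A - Q ∘L adjoint Q) x) x| ≤ ε * ‖x‖ * ‖x‖ :=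
    (abs_real_inner_le_norm _ _).trans
      (mul_le_mul_of_nonneg_right (ContinuousLinearMap.le_of_opNorm_le _ hA x) (norm_nonneg x))
  nlinarith [(abs_le.1 hE).1, sq_nonneg ‖adjoint Q x‖]

theorem IsSingularBasis.half_le_of_lt_finrank (h : IsSingularBasis A u lam)
    (hP : IsMoorePenroseInverse Q P) (hρ : 0 < ρ) (hQ : ∀ v, ρ * ‖v‖ ^ 2 ≤ ‖Q v‖ ^ 2)
    (hA : ‖A - Q ∘L adjoint Q‖ ≤ ε) (hε : ε ≤ ρ / 4) {k : Fin N} (hk : k < Module.finrank ℝ F) :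
    ρ / 2 ≤ lam k := by
  linarith [h.sub_le_of_lt_finrank hP hρ hQ hA hk]

theorem IsSingularBasis.apply_eq_smul_of_lt_finrank (h : IsSingularBasis A u lam)
    (hP : IsMoorePenroseInverse Q P) (hρ : 0 < ρ) (hQ : ∀ v, ρ * ‖v‖ ^ 2 ≤ ‖Q v‖ ^ 2)
    (hA : ‖A - Q ∘L adjoint Q‖ ≤ ε) (hε : ε ≤ ρ / 4) {k : Fin N} (hk : k < Module.finrank ℝ F) :
    A (u k) = lam k • u k :=
  h.apply_eq_smul (neg_mul_norm_sq_le_inner hA)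
    (by linarith [h.half_le_of_lt_finrank hP hρ hQ hA hε hk])

theorem IsSingularBasis.norm_truncatedInverse_sub_le [FiniteDimensional ℝ F]
    (h : IsSingularBasis A u lam) (hP : IsMoorePenroseInverse Q P) (hρ : 0 < ρ)
    (hQ : ∀ v, ρ * ‖v‖ ^ 2 ≤ ‖Q v‖ ^ 2) (hA : ‖A - Q ∘L adjoint Q‖ ≤ ε) (hε : ε ≤ ρ / 4) :
    ‖truncatedInverse u lam (Module.finrank ℝ F) - adjoint P ∘L P‖ ≤ 8 * ε / ρ ^ 2 := by
  set m := Module.finrank ℝ F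
  have hε0 : 0 ≤ ε := (norm_nonneg _).trans hA
  have hlarge : ∀ k : Fin N, k < m → ρ / 2 ≤ lam k := fun k hk =>
    h.half_le_of_lt_finrank hP hρ hQ hA hε hk
  have hpos : ∀ k : Fin N, k < m → 0 < lam k := fun k hk => by linarith [hlarge k hk]
  have hmul := h.truncatedInverse_mul hpos fun k hk =>
    h.apply_eq_smul_of_lt_finrank hP hρ hQ hA hε hk
  refine norm_sub_le_of_approx_inverse (b := Q ∘L adjoint Q) hρ ?_
    (hP.norm_adjoint_comp_self_le hρ hQ) hA ?_ hP.gram_mul_gram_mul hP.gram_mul_mul_self ?_ ?_ ?_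
  · refine norm_diagonalOperator_le u (by positivity) fun k => ?_
    split_ifs with hk
    · rw [abs_of_pos (inv_pos.2 (hpos k hk)), ← inv_div]
      exact inv_anti₀ (by positivity) (hlarge k hk)
    · simpa using (by positivity : 0 ≤ 2 / ρ)
  · rw [mul_assoc, hmul, truncatedInverse, diagonalOperator_mul]
    congr 1
    ext k
    by_cases hk : (k : ℕ) < m <;> simp [hk]
  · rw [hmul, one_sub_diagonalOperator]
    refine norm_diagonalOperator_le u zero_le_one fun k => ?_
    simp only [Pi.sub_apply, Pi.one_apply]
    split_ifs <;> simp
  · rw [hmul]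
    exact h.norm_one_sub_diagonalOperator_mul_le hε0 fun k hk => h.le_of_finrank_le hA hk
  · rw [hP.gram_mul]
    exact hP.norm_one_sub_le

theorem IsSingularBasis.abs_inner_truncatedInverse_sub_le [FiniteDimensional ℝ F]
    (h : IsSingularBasis A u lam) (hP : IsMoorePenroseInverse Q P) (hρ : 0 < ρ)
    (hQ : ∀ v, ρ * ‖v‖ ^ 2 ≤ ‖Q v‖ ^ 2) (hA : ‖A - Q ∘L adjoint Q‖ ≤ ε) (hε : ε ≤ ρ / 4)
    {C : ℝ} {x y : H} (hAx : ‖A x‖ ≤ C) (hAy : ‖A y‖ ≤ C) (hQx : ‖adjoint Q x‖ ≤ 1)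
    (hQy : ‖adjoint Q y‖ ≤ 1) (hEx : ‖adjoint Q ((A - Q ∘L adjoint Q) x)‖ ≤ ε)
    (hEy : ‖adjoint Q ((A - Q ∘L adjoint Q) y)‖ ≤ ε) :
    |inner ℝ (truncatedInverse u lam (Module.finrank ℝ F) (A x)) (A y) -
      inner ℝ (adjoint Q x) (adjoint Q y)| ≤ 8 * ε / ρ ^ 2 * C ^ 2 + 3 * (ε / ρ) := by
  set T := truncatedInverse u lam (Module.finrank ℝ F)
  have hPA : ∀ z, P (A z) = adjoint Q z + P ((A - Q ∘L adjoint Q) z) := fun z => by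
    rw [sub_apply, map_sub, ContinuousLinearMap.comp_apply, hP.apply_apply]
    abel
  have hPE : ∀ z, ‖adjoint Q ((A - Q ∘L adjoint Q) z)‖ ≤ ε →
      ‖P ((A - Q ∘L adjoint Q) z)‖ ≤ ε / ρ := fun z hz => by
    rw [le_div_iff₀' hρ]
    exact (hP.mul_norm_apply_le hQ _).trans hz
  have hnoise : |inner ℝ (P (A x)) (P (A y)) - inner ℝ (adjoint Q x) (adjoint Q y)| ≤
      3 * (ε / ρ) := by
    rw [hPA, hPA]
    exact abs_inner_add_add_sub_inner_le hQx hQy (hPE x hEx) (hPE y hEy)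
      ((div_le_one hρ).2 (by linarith))
  have hclose := h.norm_truncatedInverse_sub_le hP hρ hQ hA hε
  have htrunc : |inner ℝ (T (A x)) (A y) - inner ℝ (P (A x)) (P (A y))| ≤
      8 * ε / ρ ^ 2 * C ^ 2 := by
    rw [← ContinuousLinearMap.adjoint_inner_left P, ← inner_sub_left]
    calc _ ≤ ‖(T - adjoint P ∘L P) (A x)‖ * ‖A y‖ := abs_real_inner_le_norm _ _
      _ ≤ 8 * ε / ρ ^ 2 * C * C := by
        have hC : 0 ≤ C := (norm_nonneg _).trans hAx
        have hε0 : 0 ≤ 8 * ε / ρ ^ 2 := (norm_nonneg _).trans hclose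
        gcongr
        exact ContinuousLinearMap.le_of_opNorm_le_of_le _ hclose hAx
      _ = 8 * ε / ρ ^ 2 * C ^ 2 := by ring
  linarith [abs_sub_le (inner ℝ (T (A x)) (A y)) (inner ℝ (P (A x)) (P (A y)))
    (inner ℝ (adjoint Q x) (adjoint Q y))]

end PerturbedGram

end Wedin

section GramEmbedding

open ContinuousLinearMap (adjoint)

variable {V F : Type*} [Fintype V] [NormedAddCommGroup F] [InnerProductSpace ℝ F]
  [FiniteDimensional ℝ F]

/-- The analysis operator `v ↦ (⟨Y i, v⟩)ᵢ` of a finite family of vectors. -/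
noncomputable def analysisMap (Y : V → F) : F →L[ℝ] EuclideanSpace ℝ V :=
  LinearMap.toContinuousLinearMap
    ((WithLp.linearEquiv 2 ℝ (V → ℝ)).symm.toLinearMap ∘ₗ LinearMap.pi fun i => innerₛₗ ℝ (Y i))

theorem analysisMap_apply (Y : V → F) (v : F) (i : V) : analysisMap Y v i = inner ℝ (Y i) v :=
  rfl

theorem norm_analysisMap_apply_sq (Y : V → F) (v : F) :
    ‖analysisMap Y v‖ ^ 2 = ∑ i, inner ℝ (Y i) v ^ 2 := by
  simp [EuclideanSpace.norm_sq_eq, analysisMap_apply]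

theorem adjoint_analysisMap_apply [CompleteSpace F] (Y : V → F) (h : EuclideanSpace ℝ V) :
    adjoint (analysisMap Y) h = ∑ i, h i • Y i := by
  refine ext_inner_left ℝ fun v => ?_
  rw [ContinuousLinearMap.adjoint_inner_right, PiLp.inner_apply, inner_sum]
  refine Finset.sum_congr rfl fun i _ => ?_
  rw [analysisMap_apply, real_inner_smul_right, RCLike.inner_apply, conj_trivial, real_inner_comm]

variable [DecidableEq V]

theorem toEuclideanCLM_apply (A : Matrix V V ℝ) (h : EuclideanSpace ℝ V) (i : V) :
    Matrix.toEuclideanCLM (𝕜 := ℝ) A h i = ∑ j, A i j * h j := by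
  rw [Matrix.ofLp_toEuclideanCLM]
  rfl

theorem toEuclideanCLM_single (A : Matrix V V ℝ) (i j : V) :
    Matrix.toEuclideanCLM (𝕜 := ℝ) A (EuclideanSpace.single i 1) j = A j i := by
  simp [toEuclideanCLM_apply]

theorem inner_toEuclideanCLM_left {A : Matrix V V ℝ} (hA : A.IsSymm) (x y : EuclideanSpace ℝ V) :
    inner ℝ (Matrix.toEuclideanCLM (𝕜 := ℝ) A x) y =
      inner ℝ x (Matrix.toEuclideanCLM (𝕜 := ℝ) A y) := by
  have hstar : star (Matrix.toEuclideanCLM (𝕜 := ℝ) A) = Matrix.toEuclideanCLM (𝕜 := ℝ) A := by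
    rw [← map_star, Matrix.star_eq_conjTranspose, Matrix.conjTranspose_eq_transpose_of_trivial,
      hA.eq]
  exact ContinuousLinearMap.isSelfAdjoint_iff_isSymmetric.1 hstar x y

theorem sum_dite_lt_eq {N m : ℕ} (f : Fin N → ℝ) :
    (∑ a : Fin m, if h : (a : ℕ) < N then f ⟨a, h⟩ else 0) =
      ∑ k : Fin N, if (k : ℕ) < m then f k else 0 := by
  let g : ℕ → ℝ := fun a => if h : a < N then f ⟨a, h⟩ else 0
  calc (∑ a : Fin m, g a) = ∑ a ∈ Finset.range m with a < N, g a := by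
        rw [Fin.sum_univ_eq_sum_range, Finset.sum_filter_of_ne]
        intro a _ ha
        by_contra hN
        exact ha (dif_neg hN)
    _ = ∑ a ∈ Finset.range N with a < m, g a := by
        congr 1
        ext a
        simp [and_comm]
    _ = ∑ k : Fin N, if (k : ℕ) < m then g k else 0 := by
        rw [Finset.sum_filter, Fin.sum_univ_eq_sum_range fun a => if a < m then g a else 0]
    _ = ∑ k : Fin N, if (k : ℕ) < m then f k else 0 := by simp [g]

theorem IsASE.exists_isSingularBasis {m : ℕ} {A : Matrix V V ℝ} (hA : A.IsSymm)
    {Xhat : V → EuclideanSpace ℝ (Fin m)} (hX : IsASE A Xhat) :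
    ∃ (u : OrthonormalBasis (Fin (Fintype.card V)) ℝ (EuclideanSpace ℝ V))
      (lam : Fin (Fintype.card V) → ℝ), IsSingularBasis (Matrix.toEuclideanCLM (𝕜 := ℝ) A) u lam ∧
      ∀ i j, inner ℝ (Xhat i) (Xhat j) =
        ∑ k : Fin _, if (k : ℕ) < m then lam k * (u k i * u k j) else 0 := by
  obtain ⟨B, u, lam, hB, hBB, hanti, hu, hX⟩ := hX
  have hu' : ∀ k, Matrix.toEuclideanCLM (𝕜 := ℝ) B (u k) = lam k • u k := hu
  have hnonneg : ∀ k, 0 ≤ lam k := fun k => by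
    have hquad : 0 ≤ inner ℝ (u k) (Matrix.toEuclideanCLM (𝕜 := ℝ) B (u k)) := by
      simpa [PiLp.inner_apply, dotProduct, mul_comm] using
        hB.dotProduct_mulVec_nonneg (u k).ofLp
    simpa [hu', inner_smul_right] using hquad
  have hsq : ∀ x, Matrix.toEuclideanCLM (𝕜 := ℝ) A (Matrix.toEuclideanCLM (𝕜 := ℝ) A x) =
      Matrix.toEuclideanCLM (𝕜 := ℝ) B (Matrix.toEuclideanCLM (𝕜 := ℝ) B x) := fun x => by
    rw [← mul_apply_eq_comp, ← mul_apply_eq_comp, ← map_mul, ← map_mul, hBB, hA.eq]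
  refine ⟨u, lam, ⟨inner_toEuclideanCLM_left hA, hanti, hnonneg, fun k => ?_⟩, fun i j => ?_⟩
  · rw [hsq, hu', map_smul, hu', smul_smul, sq]
  · rw [← sum_dite_lt_eq fun k => lam k * (u k i * u k j), PiLp.inner_apply]
    refine Finset.sum_congr rfl fun a _ => ?_
    rw [hX, hX, RCLike.inner_apply, conj_trivial]
    split_ifs with ha
    · linear_combination u ⟨a, ha⟩ i * u ⟨a, ha⟩ j * Real.mul_self_sqrt (hnonneg ⟨a, ha⟩)
    · simp

theorem analysisMap_comp_adjoint [CompleteSpace F] (Y : V → F) :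
    analysisMap Y ∘L adjoint (analysisMap Y) =
      Matrix.toEuclideanCLM (𝕜 := ℝ) (Matrix.gram ℝ Y) := by
  ext h i
  simp [analysisMap_apply, adjoint_analysisMap_apply, toEuclideanCLM_apply, Matrix.gram_apply,
    mul_comm]

theorem IsASE.abs_inner_sub_inner_le {m : ℕ} (hm : Module.finrank ℝ F = m) {A : Matrix V V ℝ}
    (hA : A.IsSymm) {Y : V → F} {n l δ : ℝ} (hn : 0 < n) (hl : 0 < l) (hδ : δ ≤ l / 4)
    (hframe : ∀ v, l * n * ‖v‖ ^ 2 ≤ ∑ i, inner ℝ (Y i) v ^ 2) (hY : ∀ i, ‖Y i‖ ≤ 1)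
    (hrow : ∀ i, ∑ j, A i j ^ 2 ≤ n)
    (hnoise : ‖Matrix.toEuclideanCLM (𝕜 := ℝ) (A - Matrix.gram ℝ Y)‖ ≤ δ * n)
    (hnoiseY : ∀ i, ‖∑ j, (A i j - inner ℝ (Y i) (Y j)) • Y j‖ ≤ δ * n)
    {Xhat : V → EuclideanSpace ℝ (Fin m)} (hX : IsASE A Xhat) (i j : V) :
    |inner ℝ (Xhat i) (Xhat j) - inner ℝ (Y i) (Y j)| ≤ (8 / l ^ 2 + 3 / l) * δ := by
  have : CompleteSpace F := FiniteDimensional.complete ℝ F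
  obtain ⟨u, lam, hu, hgram⟩ := hX.exists_isSingularBasis hA
  set Q := analysisMap Y
  have hρ : 0 < l * n := mul_pos hl hn
  have hQ : ∀ v, l * n * ‖v‖ ^ 2 ≤ ‖Q v‖ ^ 2 := fun v =>
    (hframe v).trans_eq (norm_analysisMap_apply_sq Y v).symm
  obtain ⟨P, hP⟩ := exists_isMoorePenroseInverse hρ hQ
  have hE : Matrix.toEuclideanCLM (𝕜 := ℝ) A - Q ∘L adjoint Q =
      Matrix.toEuclideanCLM (𝕜 := ℝ) (A - Matrix.gram ℝ Y) := by
    rw [analysisMap_comp_adjoint, map_sub]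
  rw [← hE] at hnoise
  have hε : δ * n ≤ l * n / 4 := by nlinarith
  have hcol : ∀ i, ‖Matrix.toEuclideanCLM (𝕜 := ℝ) A (EuclideanSpace.single i 1)‖ ≤ √n :=
    fun i => by
      refine Real.le_sqrt_of_sq_le (le_of_eq_of_le ?_ (hrow i))
      simp only [EuclideanSpace.norm_sq_eq, toEuclideanCLM_single, Real.norm_eq_abs, sq_abs,
        hA.apply i]
  have hQsingle : ∀ i, adjoint Q (EuclideanSpace.single i 1) = Y i := fun i => by
    simp [Q, adjoint_analysisMap_apply]
  have hQnoise : ∀ i, ‖adjoint Q ((Matrix.toEuclideanCLM (𝕜 := ℝ) A - Q ∘L adjoint Q)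
      (EuclideanSpace.single i 1))‖ ≤ δ * n := fun i => by
    refine le_of_eq_of_le ?_ (hnoiseY i)
    simp only [hE, Q, adjoint_analysisMap_apply, toEuclideanCLM_single, Matrix.sub_apply,
      Matrix.gram_apply, hA.apply i, real_inner_comm]
  have hmain := hu.abs_inner_truncatedInverse_sub_le hP hρ hQ hnoise hε (hcol i) (hcol j)
    (by simpa [hQsingle] using hY i) (by simpa [hQsingle] using hY j) (hQnoise i) (hQnoise j)
  rw [hu.inner_truncatedInverse_apply_apply
    (fun k hk => (half_pos hρ).trans_le (hu.half_le_of_lt_finrank hP hρ hQ hnoise hε hk))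
    (fun k hk => hu.apply_eq_smul_of_lt_finrank hP hρ hQ hnoise hε hk), hQsingle, hQsingle, hm]
    at hmain
  simp only [EuclideanSpace.inner_single_right, conj_trivial, one_mul, ← hgram] at hmain
  refine hmain.trans_eq ?_
  rw [Real.sq_sqrt hn.le]
  field_simp

end GramEmbedding

section Seeds

/-- The threshold `t` separates the inner products inside the classes of `cl` from those between
different classes. -/
structure SeparatesClasses {V C E : Type*} [NormedAddCommGroup E] [InnerProductSpace ℝ E]
    (Xhat : V → E) (cl : V → C) (t : ℝ) : Prop where
  lt_inner : ∀ ⦃i j⦄, cl i = cl j → t < inner ℝ (Xhat i) (Xhat j)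
  inner_lt : ∀ ⦃i j⦄, cl i ≠ cl j → inner ℝ (Xhat i) (Xhat j) < t

variable {R d n D : ℕ} {cl : Fin n → Fin R} {t : ℝ}

theorem SeparatesClasses.surjective_comp_of_forall_lt {Xhat : Fin n → EuclideanSpace ℝ (Fin D)}
    (h : SeparatesClasses Xhat cl t) {s : Fin R → Fin n}
    (hs : ∀ y z, y ≠ z → inner ℝ (Xhat (s y)) (Xhat (s z)) < t) :
    Function.Surjective (cl ∘ s) := by
  refine Finite.injective_iff_surjective.1 fun y z hyz => ?_
  by_contra hne
  exact lt_asymm (hs y z hne) (h.lt_inner hyz)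

namespace SeedStep

variable {Xhat : Fin n → EuclideanSpace ℝ (Fin D)} {i : Fin n} {s s' : Fin R → Fin n}

theorem range_comp_subset (hstep : SeedStep Xhat i s s') (h : SeparatesClasses Xhat cl t) :
    Set.range (cl ∘ s) ⊆ Set.range (cl ∘ s') := by
  obtain ⟨y, z, hyz, hmax, ⟨hle, rfl⟩ | ⟨-, rfl⟩⟩ := hstep
  · rintro _ ⟨j, rfl⟩
    rcases ne_or_eq j z with hjz | rfl
    · exact ⟨j, by simp [hjz]⟩
    by_cases hcl : cl (s y) = cl (s j)
    · exact ⟨y, by simp [hyz, hcl]⟩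
    have hlt := h.inner_lt hcl
    obtain ⟨k, hk⟩ := h.surjective_comp_of_forall_lt
      (fun y' z' hne => (hmax y' z' hne).trans_lt hlt) (cl i)
    exact absurd ((h.lt_inner hk.symm).trans_le (hle k)) hlt.not_gt
  · exact subset_rfl

theorem apply_mem_range_comp (hstep : SeedStep Xhat i s s') (h : SeparatesClasses Xhat cl t) :
    cl i ∈ Set.range (cl ∘ s') := by
  obtain ⟨y, z, -, hmax, ⟨-, rfl⟩ | ⟨⟨j, hj⟩, rfl⟩⟩ := hstep
  · exact ⟨z, by simp⟩
  · by_cases hcl : cl i = cl (s' j)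
    · exact ⟨j, hcl.symm⟩
    · exact h.surjective_comp_of_forall_lt
        (fun y' z' hne => (hmax y' z' hne).trans_lt (hj.trans_lt (h.inner_lt hcl))) (cl i)

end SeedStep

namespace AlgorithmRun

variable {G : SimpleGraph (Fin n)}

theorem apply_mem_range_comp_seeds (run : AlgorithmRun R d G)
    (h : SeparatesClasses run.Xhat cl t) (k : Fin (n + 1)) {i : Fin n} (hi : (i : ℕ) < k) :
    cl i ∈ Set.range (cl ∘ run.seeds k) := by
  induction k using Fin.induction with
  | zero => simp at hi
  | succ k ih =>
    rcases Nat.lt_succ_iff_lt_or_eq.1 (show (i : ℕ) < k + 1 from hi) with hlt | heq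
    · exact (run.seedStep k).range_comp_subset h (ih hlt)
    · rw [Fin.ext heq]
      exact (run.seedStep k).apply_mem_range_comp h

theorem bijective_comp_seeds_last (run : AlgorithmRun R d G) (hcl : Function.Surjective cl)
    (h : SeparatesClasses run.Xhat cl t) :
    Function.Bijective (cl ∘ run.seeds (Fin.last n)) := by
  have hsurj : Function.Surjective (cl ∘ run.seeds (Fin.last n)) := fun r => by
    obtain ⟨i, rfl⟩ := hcl r
    exact run.apply_mem_range_comp_seeds h (Fin.last n) i.2
  exact ⟨Finite.injective_iff_surjective.2 hsurj, hsurj⟩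

theorem apply_seed_τhat (run : AlgorithmRun R d G) (hcl : Function.Surjective cl)
    (h : SeparatesClasses run.Xhat cl t) (i : Fin n) :
    cl (run.seeds (Fin.last n) (run.τhat i)) = cl i := by
  obtain ⟨j, hj⟩ := (run.bijective_comp_seeds_last hcl h).2 (cl i)
  by_contra hne
  exact lt_asymm ((h.lt_inner hj.symm).trans_le (run.argmax i j)) (h.inner_lt (Ne.symm hne))

theorem exists_perm_Hhat_eq (run : AlgorithmRun R d G) (hcl : Function.Surjective cl)
    (h : SeparatesClasses run.Xhat cl t) :
    ∃ σ : Equiv.Perm (Fin R), ∀ r, run.Hhat (σ r) = Finset.univ.filter fun i => cl i = r := by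
  have hbij := run.bijective_comp_seeds_last hcl h
  refine ⟨(Equiv.ofBijective _ hbij).symm, fun r => ?_⟩
  obtain ⟨j, rfl⟩ := hbij.2 r
  have hj : (Equiv.ofBijective _ hbij).symm ((cl ∘ run.seeds (Fin.last n)) j) = j :=
    (Equiv.ofBijective _ hbij).symm_apply_apply j
  rw [hj]
  ext i
  simp only [Hhat, cluster, Finset.mem_insert, Finset.mem_filter, Finset.mem_univ, true_and]
  constructor
  · rintro (rfl | rfl)
    · rfl
    · exact (run.apply_seed_τhat hcl h i).symm
  · exact fun hi => Or.inr (hbij.1 ((run.apply_seed_τhat hcl h i).trans hi))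

end AlgorithmRun

end Seeds

section Statistic

open Filter Topology

theorem isProperMap_gram {κ E : Type*} [Finite κ] [NormedAddCommGroup E]
    [InnerProductSpace ℝ E] [FiniteDimensional ℝ E] :
    IsProperMap fun (z : κ → E) a b => inner ℝ (z a) (z b) := by
  have := Fintype.ofFinite κ
  have hcont : Continuous fun (z : κ → E) a b => inner ℝ (z a) (z b) := by fun_prop
  refine isProperMap_iff_isCompact_preimage.2 ⟨hcont, fun S hS => ?_⟩
  obtain ⟨C, hC⟩ := hS.isBounded.exists_norm_le
  refine Metric.isCompact_of_isClosed_isBounded (hS.isClosed.preimage hcont)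
    (isBounded_iff_forall_norm_le.2 ⟨Real.sqrt C, fun z hz =>
      (pi_norm_le_iff_of_nonneg (Real.sqrt_nonneg C)).2 fun a => Real.le_sqrt_of_sq_le ?_⟩)
  rw [← real_inner_self_eq_norm_sq]
  set Γ : κ → κ → ℝ := fun a b => inner ℝ (z a) (z b)
  exact (le_abs_self _).trans
    ((norm_le_pi_norm (Γ a) a).trans ((norm_le_pi_norm Γ a).trans (hC Γ hz)))

theorem eventually_exists_gram_eq_of_gram_close {κ E : Type*} [Finite κ] [NormedAddCommGroup E]
    [InnerProductSpace ℝ E] [FiniteDimensional ℝ E] (Γ : κ → κ → ℝ) {ε : ℝ} (hε : 0 < ε) :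
    ∀ᶠ δ in 𝓝[>] (0 : ℝ), ∀ z : κ → E, (∀ a b, |inner ℝ (z a) (z b) - Γ a b| ≤ δ) →
      ∃ y : κ → E, (∀ a b, inner ℝ (y a) (y b) = Γ a b) ∧ ∀ a, ‖z a - y a‖ ≤ ε := by
  have := Fintype.ofFinite κ
  have hfiber := isProperMap_gram.isClosedMap.eventually_nhds_fiber
    (p := fun z : κ → E => ∃ y : κ → E, (∀ a b, inner ℝ (y a) (y b) = Γ a b) ∧ ‖z - y‖ ≤ ε) Γ
    fun y hy => by
      filter_upwards [Metric.closedBall_mem_nhds y hε] with z hz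
      exact ⟨y, fun a b => congrFun₂ hy a b, mem_closedBall_iff_norm.1 hz⟩
  obtain ⟨δ₀, hδ₀, hball⟩ := Metric.nhds_basis_closedBall.eventually_iff.1 hfiber
  filter_upwards [Ioc_mem_nhdsGT hδ₀] with δ hδ z hz
  obtain ⟨y, hy, hzy⟩ := hball ((dist_pi_le_iff hδ₀.le).2 fun a =>
    (dist_pi_le_iff hδ₀.le).2 fun b => (hz a b).trans hδ.2) z rfl
  exact ⟨y, hy, fun a => (norm_le_pi_norm (z - y) a).trans hzy⟩

theorem norm_sub_sq_le_of_inner_close {E : Type*} [NormedAddCommGroup E] [InnerProductSpace ℝ E]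
    {a b : E} {c δ : ℝ} (haa : |inner ℝ a a - c| ≤ δ) (hab : |inner ℝ a b - c| ≤ δ)
    (hbb : |inner ℝ b b - c| ≤ δ) : ‖a - b‖ ^ 2 ≤ 4 * δ := by
  rw [norm_sub_sq_real, ← real_inner_self_eq_norm_sq, ← real_inner_self_eq_norm_sq]
  linarith [(abs_le.1 haa).2, (abs_le.1 hab).1, (abs_le.1 hbb).2]

section Alignment

variable {V ι : Type*} [Fintype ι] {d : ℕ} {H : Finset V} {X : V → EuclideanSpace ℝ ι}

theorem IsLatentOn.apply_eq_of_eq {Y : V → EuclideanSpace ℝ (Fin d)} (hY : IsLatentOn H X Y)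
    {i j : V} (hi : i ∈ H) (hj : j ∈ H) (hij : X i = X j) : Y i = Y j := by
  have : ‖Y i - Y j‖ ^ 2 ≤ 4 * 0 := norm_sub_sq_le_of_inner_close (c := inner ℝ (X i) (X i))
    (by rw [hY i hi i hi, sub_self, abs_zero]) (by rw [hY i hi j hj, ← hij, sub_self, abs_zero])
    (by rw [hY j hj j hj, ← hij, sub_self, abs_zero])
  simpa [sub_eq_zero] using this

open scoped Classical in
theorem IsAlignedLatent.norm_sub_le {Xhat Y Y' : V → EuclideanSpace ℝ (Fin d)}
    (hY : IsAlignedLatent H X Xhat Y) (hY' : IsLatentOn H X Y') {e w : ℝ} (hw : 0 < w)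
    (he : ∀ j ∈ H, ‖Xhat j - Y' j‖ ≤ e) {i : V} (hi : i ∈ H)
    (hcount : w * H.card ≤ (H.filter fun j => X j = X i).card) :
    ‖Xhat i - Y i‖ ≤ 2 * e + e / Real.sqrt w := by
  have he0 : 0 ≤ e := (norm_nonneg _).trans (he i hi)
  have hH : (0 : ℝ) < H.card := by exact_mod_cast Finset.card_pos.2 ⟨i, hi⟩
  set t := ‖Y' i - Y i‖
  have htri : ‖Xhat i - Y i‖ ≤ e + t :=
    (norm_sub_le_norm_sub_add_norm_sub _ (Y' i) _).trans (by gcongr; exact he i hi)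
  suffices t - e ≤ e / Real.sqrt w by linarith
  rcases le_total t e with hte | hte
  · exact (sub_nonpos.2 hte).trans (by positivity)
  -- `Y` and `Y'` are constant on the fibre of `X`, so a large `t` is paid on the whole fibre.
  have hfiber : ∀ j ∈ H.filter fun j => X j = X i, (t - e) ^ 2 ≤ ‖Xhat j - Y j‖ ^ 2 := by
    intro j hj
    obtain ⟨hjH, hji⟩ := Finset.mem_filter.1 hj
    have := norm_sub_le_norm_sub_add_norm_sub (Y' j) (Xhat j) (Y j)
    rw [norm_sub_rev (Y' j) (Xhat j), hY'.apply_eq_of_eq hjH hi hji,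
      hY.1.apply_eq_of_eq hjH hi hji] at this
    rw [hY.1.apply_eq_of_eq hjH hi hji]
    have hj' := he j hjH
    rw [hY'.apply_eq_of_eq hjH hi hji] at hj'
    exact pow_le_pow_left₀ (sub_nonneg.2 hte) (by linarith) 2
  have hsum : w * H.card * (t - e) ^ 2 ≤ H.card * e ^ 2 := calc
    w * H.card * (t - e) ^ 2 ≤ (H.filter fun j => X j = X i).card • (t - e) ^ 2 := by
      rw [nsmul_eq_mul]; gcongr
    _ ≤ ∑ j ∈ H.filter fun j => X j = X i, ‖Xhat j - Y j‖ ^ 2 :=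
      Finset.card_nsmul_le_sum _ _ _ hfiber
    _ ≤ ∑ j ∈ H, ‖Xhat j - Y j‖ ^ 2 :=
      Finset.sum_le_sum_of_subset_of_nonneg (Finset.filter_subset _ _) fun _ _ _ => sq_nonneg _
    _ ≤ ∑ j ∈ H, ‖Xhat j - Y' j‖ ^ 2 := hY.2 Y' hY'
    _ ≤ H.card • e ^ 2 := Finset.sum_le_card_nsmul _ _ _ fun j hj =>
      pow_le_pow_left₀ (norm_nonneg _) (he j hj) 2
    _ = H.card * e ^ 2 := nsmul_eq_mul _ _
  rw [le_div_iff₀ (Real.sqrt_pos.2 hw)]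
  refine le_of_sq_le_sq ?_ he0
  rw [mul_pow, Real.sq_sqrt hw.le]
  exact le_of_mul_le_mul_left (by linarith) hH

theorem eventually_exists_isLatentOn_norm_sub_le {κ : Type*} [Finite κ]
    (x : κ → EuclideanSpace ℝ ι) {ε : ℝ} (hε : 0 < ε) :
    ∀ᶠ δ in 𝓝[>] (0 : ℝ), ∀ {V : Type*} (H : Finset V) (X : V → EuclideanSpace ℝ ι)
      (Xhat : V → EuclideanSpace ℝ (Fin d)),
      X '' H = Set.range x →
      (∀ i ∈ H, ∀ j ∈ H, |inner ℝ (Xhat i) (Xhat j) - inner ℝ (X i) (X j)| ≤ δ) →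
      ∃ Y, IsLatentOn H X Y ∧ ∀ i ∈ H, ‖Xhat i - Y i‖ ≤ ε := by
  filter_upwards [eventually_exists_gram_eq_of_gram_close (E := EuclideanSpace ℝ (Fin d))
    (fun a b : κ => inner ℝ (x a) (x b)) (half_pos hε),
    Ioc_mem_nhdsGT (show 0 < (ε / 2) ^ 2 / 4 by positivity)] with δ hgram hδ V H X Xhat hX hclose
  have hrep : ∀ a, ∃ i ∈ H, X i = x a := fun a => hX.ge ⟨a, rfl⟩
  choose rep hrepH hrepX using hrep
  obtain ⟨y, hy, hrepy⟩ := hgram (fun a => Xhat (rep a)) fun a b => by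
    simpa only [hrepX] using hclose _ (hrepH a) _ (hrepH b)
  rcases H.eq_empty_or_nonempty with rfl | ⟨i₀, hi₀⟩
  · exact ⟨Xhat, by simp [IsLatentOn], by simp⟩
  obtain ⟨a₀, -⟩ := hX.le ⟨i₀, hi₀, rfl⟩
  have : Nonempty κ := ⟨a₀⟩
  have hval : ∀ i ∈ H, ∃ a, x a = X i := fun i hi => hX.le ⟨i, hi, rfl⟩
  choose! val hval using hval
  refine ⟨fun i => y (val i), fun i hi j hj => by rw [hy, hval i hi, hval j hj], fun i hi => ?_⟩
  have hXi : X i = X (rep (val i)) := by rw [hrepX, hval i hi]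
  have hfiber : ‖Xhat i - Xhat (rep (val i))‖ ≤ ε / 2 := by
    refine le_of_sq_le_sq ?_ (half_pos hε).le
    refine (norm_sub_sq_le_of_inner_close (hclose i hi i hi) ?_ ?_).trans
      (by linarith [hδ.2])
    · simpa only [hXi] using hclose i hi _ (hrepH (val i))
    · simpa only [hXi] using hclose _ (hrepH (val i)) _ (hrepH (val i))
  calc ‖Xhat i - y (val i)‖ ≤ ‖Xhat i - Xhat (rep (val i))‖ + ‖Xhat (rep (val i)) - y (val i)‖ :=
        norm_sub_le_norm_sub_add_norm_sub _ _ _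
    _ ≤ ε / 2 + ε / 2 := add_le_add hfiber (hrepy _)
    _ = ε := add_halves ε

open scoped Classical in
theorem IsAlignedLatent.eventually_norm_sub_le {κ : Type*} [Finite κ]
    (x : κ → EuclideanSpace ℝ ι) {w ε : ℝ} (hw : 0 < w) (hε : 0 < ε) :
    ∀ᶠ δ in 𝓝[>] (0 : ℝ), ∀ {V : Type*} (H : Finset V) (X : V → EuclideanSpace ℝ ι)
      (Xhat Y : V → EuclideanSpace ℝ (Fin d)),
      X '' H = Set.range x →
      (∀ a, w * H.card ≤ (H.filter fun i => X i = x a).card) →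
      (∀ i ∈ H, ∀ j ∈ H, |inner ℝ (Xhat i) (Xhat j) - inner ℝ (X i) (X j)| ≤ δ) →
      IsAlignedLatent H X Xhat Y → ∀ i ∈ H, ‖Xhat i - Y i‖ ≤ ε := by
  have hpos : 0 < 2 + 1 / Real.sqrt w := by positivity
  filter_upwards [eventually_exists_isLatentOn_norm_sub_le (d := d) x (div_pos hε hpos)]
    with δ hδ V H X Xhat Y hX hcount hclose hY i hi
  obtain ⟨Y', hY', hXhatY'⟩ := hδ H X Xhat hX hclose
  obtain ⟨a, ha⟩ := hX.le ⟨i, hi, rfl⟩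
  refine (hY.norm_sub_le hY' hw hXhatY' hi (ha ▸ hcount a)).trans (le_of_eq ?_)
  field_simp

end Alignment

section TestStatistic

variable {V E : Type*} [NormedAddCommGroup E] {φ : ℝ → ℝ} {H H' : Finset V}
  {X X' Y Y' : V → E} {η : ℝ}

theorem exists_radial_kernel_close (hφ : Continuous φ) (hη : 0 < η) :
    ∃ δ : ℝ, 0 < δ ∧ ∀ a b a' b' : E, ‖a'‖ ≤ 1 → ‖b'‖ ≤ 1 → ‖a - a'‖ ≤ δ → ‖b - b'‖ ≤ δ →
      |φ ‖a - b‖ - φ ‖a' - b'‖| ≤ η := by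
  have huc : UniformContinuousOn φ (Set.Icc 0 4) :=
    isCompact_Icc.uniformContinuousOn_of_continuous hφ.continuousOn
  obtain ⟨δ, hδ, h⟩ := Metric.uniformContinuousOn_iff_le.1 huc η hη
  refine ⟨min 1 (δ / 2), by positivity, fun a b a' b' ha' hb' ha hb => ?_⟩
  rw [le_min_iff] at ha hb
  have hdist : |‖a - b‖ - ‖a' - b'‖| ≤ ‖a - a'‖ + ‖b - b'‖ :=
    (abs_norm_sub_norm_le _ _).trans (by rw [sub_sub_sub_comm]; exact norm_sub_le _ _)
  have hnorm' : ‖a' - b'‖ ≤ 2 := (norm_sub_le _ _).trans (by linarith)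
  have hnorm : ‖a - b‖ ≤ 4 := by linarith [le_of_abs_le hdist]
  exact h _ ⟨norm_nonneg _, hnorm⟩ _ ⟨norm_nonneg _, by linarith⟩ (hdist.trans (by linarith))

theorem abs_offDiagonal_average_sub_le [DecidableEq V] (hη : 0 ≤ η)
    (h : ∀ i ∈ H, ∀ j ∈ H, |φ ‖X i - X j‖ - φ ‖X' i - X' j‖| ≤ η) :
    |1 / ((H.card : ℝ) * ((H.card : ℝ) - 1)) * (∑ i ∈ H, ∑ j ∈ H.erase i, φ ‖X i - X j‖) -
      1 / ((H.card : ℝ) * ((H.card : ℝ) - 1)) *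
        (∑ i ∈ H, ∑ j ∈ H.erase i, φ ‖X' i - X' j‖)| ≤ η := by
  rcases H.eq_empty_or_nonempty with rfl | hne
  · simpa using hη
  have hc : (0 : ℝ) ≤ H.card - 1 := sub_nonneg.2 (by exact_mod_cast hne.card_pos)
  have hrow : ∀ i ∈ H, |∑ j ∈ H.erase i, (φ ‖X i - X j‖ - φ ‖X' i - X' j‖)| ≤
      ((H.card : ℝ) - 1) * η := fun i hi => by
    refine (Finset.abs_sum_le_sum_abs _ _).trans ((Finset.sum_le_card_nsmul _ _ η fun j hj =>
      h i hi j (Finset.mem_of_mem_erase hj)).trans_eq ?_)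
    rw [nsmul_eq_mul, Finset.card_erase_of_mem hi, Nat.cast_pred hne.card_pos]
  simp only [← mul_sub, ← Finset.sum_sub_distrib]
  rw [abs_mul, abs_of_nonneg (by positivity), one_div]
  refine inv_mul_le_of_le_mul₀ (by positivity) hη ?_
  refine (Finset.abs_sum_le_sum_abs _ _).trans
    ((Finset.sum_le_card_nsmul _ _ _ hrow).trans_eq ?_)
  rw [nsmul_eq_mul, mul_assoc]

theorem abs_cross_average_sub_le (hη : 0 ≤ η)
    (h : ∀ i ∈ H, ∀ k ∈ H', |φ ‖X i - Y k‖ - φ ‖X' i - Y' k‖| ≤ η) :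
    |2 / ((H'.card : ℝ) * H.card) * (∑ i ∈ H, ∑ k ∈ H', φ ‖X i - Y k‖) -
      2 / ((H'.card : ℝ) * H.card) * (∑ i ∈ H, ∑ k ∈ H', φ ‖X' i - Y' k‖)| ≤ 2 * η := by
  have hrow : ∀ i ∈ H, |∑ k ∈ H', (φ ‖X i - Y k‖ - φ ‖X' i - Y' k‖)| ≤ H'.card * η :=
    fun i hi => (Finset.abs_sum_le_sum_abs _ _).trans
      ((Finset.sum_le_card_nsmul _ _ η (h i hi)).trans_eq (nsmul_eq_mul _ _))
  simp only [← mul_sub, ← Finset.sum_sub_distrib]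
  rw [abs_mul, abs_of_nonneg (by positivity), div_mul_eq_mul_div, mul_div_assoc]
  refine mul_le_mul_of_nonneg_left (div_le_of_le_mul₀ (by positivity) hη ?_) zero_le_two
  refine (Finset.abs_sum_le_sum_abs _ _).trans
    ((Finset.sum_le_card_nsmul _ _ _ hrow).trans_eq ?_)
  rw [nsmul_eq_mul]; ring

theorem abs_testStatistic_sub_le [DecidableEq V] (hη : 0 ≤ η)
    (h₁ : ∀ i ∈ H, ∀ j ∈ H, |φ ‖X i - X j‖ - φ ‖X' i - X' j‖| ≤ η)
    (h₂ : ∀ i ∈ H, ∀ k ∈ H', |φ ‖X i - Y k‖ - φ ‖X' i - Y' k‖| ≤ η)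
    (h₃ : ∀ k ∈ H', ∀ l ∈ H', |φ ‖Y k - Y l‖ - φ ‖Y' k - Y' l‖| ≤ η) :
    |testStatistic φ H X H' Y - testStatistic φ H X' H' Y'| ≤ 4 * η := by
  have hH := abs_le.1 (abs_offDiagonal_average_sub_le hη h₁)
  have hcross := abs_le.1 (abs_cross_average_sub_le hη h₂)
  have hH' := abs_le.1 (abs_offDiagonal_average_sub_le hη h₃)
  simp only [testStatistic]
  exact abs_le.2 ⟨by linarith [hH.1, hcross.2, hH'.1], by linarith [hH.2, hcross.1, hH'.2]⟩

end TestStatistic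

end Statistic

section Typical

open Filter Topology

theorem sum_sum_mul_sq_le_of_almost_orthogonal {W V : Type*} [Fintype W] [Fintype V]
    {E : W → V → ℝ} (hE : ∀ i j, |E i j| ≤ 1) {γ : ℝ} (hγ : 0 ≤ γ)
    (horth : ∀ i j, i ≠ j → |∑ k, E k i * E k j| ≤ γ) (h : V → ℝ) :
    ∑ k, (∑ i, E k i * h i) ^ 2 ≤ (γ * Fintype.card V + Fintype.card W) * ∑ i, h i ^ 2 := by
  classical
  have hterm : ∀ i j, (∑ k, E k i * E k j) * (h i * h j) ≤
      γ * (|h i| * |h j|) + if i = j then (Fintype.card W : ℝ) * h i ^ 2 else 0 := by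
    intro i j
    split_ifs with hij
    · subst hij
      have hcol : ∑ k, E k i * E k i ≤ Fintype.card W := by
        simpa [← pow_two] using Finset.sum_le_card_nsmul Finset.univ (fun k => E k i ^ 2) 1
          fun k _ => (sq_le_one_iff_abs_le_one _).2 (hE k i)
      rw [← pow_two (h i)]
      exact (mul_le_mul_of_nonneg_right hcol (sq_nonneg _)).trans
        (le_add_of_nonneg_left (by positivity))
    · rw [add_zero, ← abs_mul]
      exact (le_abs_self _).trans (abs_mul (∑ k, E k i * E k j) (h i * h j) ▸
        mul_le_mul_of_nonneg_right (horth i j hij) (abs_nonneg _))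
  calc ∑ k, (∑ i, E k i * h i) ^ 2
      = ∑ i, ∑ j, (∑ k, E k i * E k j) * (h i * h j) := by
        simp only [pow_two, Finset.sum_mul_sum]
        rw [Finset.sum_comm]
        refine Finset.sum_congr rfl fun i _ => ?_
        rw [Finset.sum_comm]
        simp only [Finset.sum_mul, mul_mul_mul_comm]
    _ ≤ ∑ i, ∑ j, (γ * (|h i| * |h j|) + if i = j then (Fintype.card W : ℝ) * h i ^ 2 else 0) :=
        Finset.sum_le_sum fun i _ => Finset.sum_le_sum fun j _ => hterm i j
    _ = γ * (∑ i, |h i|) ^ 2 + Fintype.card W * ∑ i, h i ^ 2 := by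
        simp only [Finset.sum_add_distrib, Finset.sum_ite_eq, Finset.mem_univ, if_true,
          ← Finset.mul_sum, ← Finset.sum_mul, pow_two (∑ i, |h i|)]
    _ ≤ γ * (Fintype.card V * ∑ i, h i ^ 2) + Fintype.card W * ∑ i, h i ^ 2 := by
        gcongr
        simpa [sq_abs] using sq_sum_le_card_mul_sum_sq (s := Finset.univ) (f := fun i => |h i|)
    _ = (γ * Fintype.card V + Fintype.card W) * ∑ i, h i ^ 2 := by ring

theorem exists_frame_bound {E : Type*} [NormedAddCommGroup E] [InnerProductSpace ℝ E]
    {s : Set E} (hs : s.Finite) :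
    ∃ l : ℝ, 0 < l ∧ ∀ v ∈ Submodule.span ℝ s, ∀ t : ℝ, 0 ≤ t → (∀ y ∈ s, |inner ℝ y v| ≤ t) →
      l * ‖v‖ ≤ t := by
  have := hs.fintype
  have : FiniteDimensional ℝ (Submodule.span ℝ s) := FiniteDimensional.span_of_finite ℝ hs
  let T : Submodule.span ℝ s →ₗ[ℝ] s → ℝ :=
    LinearMap.pi fun y => (innerₗ E (y : E)).domRestrict (Submodule.span ℝ s)
  have hker : LinearMap.ker T = ⊥ := LinearMap.ker_eq_bot'.2 fun v hv => by
    have horth : Submodule.span ℝ s ≤ LinearMap.ker ((innerₗ E).flip v) :=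
      Submodule.span_le.2 fun y hy => congrFun hv ⟨y, hy⟩
    exact Subtype.ext (inner_self_eq_zero.1 (horth v.2))
  obtain ⟨C, hC, hT⟩ := LinearMap.exists_antilipschitzWith T hker
  refine ⟨(C : ℝ)⁻¹, inv_pos.2 hC, fun v hv t ht hvt => ?_⟩
  rw [inv_mul_le_iff₀ (NNReal.coe_pos.2 hC)]
  refine (ZeroHomClass.bound_of_antilipschitz T hT ⟨v, hv⟩).trans ?_
  gcongr
  exact (pi_norm_le_iff_of_nonneg ht).2 fun y => hvt y y.2

section EdgeNoise

variable {ι : Type*} [Fintype ι] {n : ℕ}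

/-- The noise of a random dot product graph: the difference between its adjacency matrix and the
matrix of inner products of its latent positions. -/
noncomputable def edgeNoise (X : Fin n → EuclideanSpace ℝ ι) (G : SimpleGraph (Fin n)) :
    Matrix (Fin n) (Fin n) ℝ :=
  adjacency G - Matrix.gram ℝ X

theorem isSymm_adjacency (G : SimpleGraph (Fin n)) : (adjacency G).IsSymm := by
  classical exact G.isSymm_adjMatrix

theorem adjacency_mem_Icc (G : SimpleGraph (Fin n)) (i j : Fin n) :
    adjacency G i j ∈ Set.Icc (0 : ℝ) 1 := by
  classical
  rw [adjacency, SimpleGraph.adjMatrix_apply]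
  split_ifs <;> simp

theorem abs_edgeNoise_le_one {X : Fin n → EuclideanSpace ℝ ι} {i j : Fin n}
    (h : inner ℝ (X i) (X j) ∈ Set.Icc (0 : ℝ) 1) (G : SimpleGraph (Fin n)) :
    |edgeNoise X G i j| ≤ 1 := by
  obtain ⟨hA₀, hA₁⟩ := adjacency_mem_Icc G i j
  rw [edgeNoise, Matrix.sub_apply, Matrix.gram_apply, abs_le]
  exact ⟨by linarith [h.2], by linarith [h.1]⟩

end EdgeNoise

open scoped Classical in
/-- A sample of latent positions with values in the finite family `x`, together with a graph,
behaves typically up to the relative precision `δ`: every value of `x` is taken by a proportion at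
least `w` of the vertices, and the noise averages out both in products of two different columns
and over the vertices with a given latent position. -/
structure IsTypical {κ ι : Type*} [Fintype ι] {n : ℕ} (x : κ → EuclideanSpace ℝ ι) (w δ : ℝ)
    (X : Fin n → EuclideanSpace ℝ ι) (G : SimpleGraph (Fin n)) : Prop where
  one_le : 1 ≤ δ * n
  mem_range : ∀ i, X i ∈ Set.range x
  le_count : ∀ k, w * n ≤ (Finset.univ.filter fun i => X i = x k).card
  noise_mul : ∀ i j, i ≠ j → |∑ k, edgeNoise X G k i * edgeNoise X G k j| ≤ δ * n
  noise_sum : ∀ i k, |∑ j with X j = x k, edgeNoise X G i j| ≤ δ * n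

namespace IsTypical

variable {κ ι V : Type*} [Fintype ι] {n m : ℕ} {x : κ → EuclideanSpace ℝ ι} {w δ : ℝ}
  {X : Fin n → EuclideanSpace ℝ ι} {G : SimpleGraph (Fin n)}

theorem inner_mem_Icc (h : IsTypical x w δ X G)
    (hx : ∀ k l, inner ℝ (x k) (x l) ∈ Set.Icc (0 : ℝ) 1) (i j : Fin n) :
    inner ℝ (X i) (X j) ∈ Set.Icc (0 : ℝ) 1 := by
  obtain ⟨k, hk⟩ := h.mem_range i
  obtain ⟨l, hl⟩ := h.mem_range j
  exact hk ▸ hl ▸ hx k l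

theorem natCast_pos (h : IsTypical x w δ X G) (hδ : 0 < δ) : (0 : ℝ) < n :=
  pos_of_mul_pos_right (zero_lt_one.trans_le h.one_le) hδ.le

theorem norm_toEuclideanCLM_edgeNoise_le [Fintype V] [DecidableEq V] (h : IsTypical x w δ X G)
    (hx : ∀ k l, inner ℝ (x k) (x l) ∈ Set.Icc (0 : ℝ) 1) {e : V → Fin n}
    (he : Function.Injective e) {θ : ℝ} (hθ : 0 ≤ θ) (hδθ : 2 * δ ≤ θ ^ 2) :
    ‖Matrix.toEuclideanCLM (𝕜 := ℝ) ((edgeNoise X G).submatrix e e)‖ ≤ θ * n := by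
  have hδn : 0 ≤ δ * n := zero_le_one.trans h.one_le
  have hcard : (Fintype.card V : ℝ) ≤ n := by
    simpa using Fintype.card_le_of_injective e he
  refine ContinuousLinearMap.opNorm_le_bound _ (by positivity) fun v => ?_
  refine le_of_sq_le_sq ?_ (by positivity)
  calc ‖Matrix.toEuclideanCLM (𝕜 := ℝ) ((edgeNoise X G).submatrix e e) v‖ ^ 2
      = ∑ a, (∑ b, edgeNoise X G (e a) (e b) * v b) ^ 2 := by
        simp only [EuclideanSpace.real_norm_sq_eq, toEuclideanCLM_apply, Matrix.submatrix_apply]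
    _ = ∑ i ∈ Finset.univ.map ⟨e, he⟩, (∑ b, edgeNoise X G i (e b) * v b) ^ 2 :=
        (Finset.sum_map _ ⟨e, he⟩ fun i => (∑ b, edgeNoise X G i (e b) * v b) ^ 2).symm
    _ ≤ ∑ i, (∑ b, edgeNoise X G i (e b) * v b) ^ 2 :=
        Finset.sum_le_univ_sum_of_nonneg fun i => sq_nonneg _
    _ ≤ (δ * n * Fintype.card V + Fintype.card (Fin n)) * ∑ b, v b ^ 2 :=
        sum_sum_mul_sq_le_of_almost_orthogonal (E := fun i b => edgeNoise X G i (e b))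
          (fun i b => abs_edgeNoise_le_one (h.inner_mem_Icc hx _ _) G) hδn
          (fun a b hab => h.noise_mul _ _ (he.ne hab)) _
    _ ≤ (δ * n * n + 1 * n) * ∑ b, v b ^ 2 := by
        rw [Fintype.card_fin, one_mul]; gcongr
    _ ≤ (δ * n * n + δ * n * n) * ∑ b, v b ^ 2 := by
        gcongr; exact h.one_le
    _ = 2 * δ * (n ^ 2 * ‖v‖ ^ 2) := by
        rw [EuclideanSpace.real_norm_sq_eq]; ring
    _ ≤ θ ^ 2 * (n ^ 2 * ‖v‖ ^ 2) := by gcongr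
    _ = (θ * n * ‖v‖) ^ 2 := by ring

open scoped Classical in
theorem norm_sum_edgeNoise_smul_le [Fintype κ] (h : IsTypical x w δ X G) (hx : ∀ k, ‖x k‖ ≤ 1)
    (S : Set (EuclideanSpace ℝ ι)) (i : Fin n) :
    ‖∑ j with X j ∈ S, edgeNoise X G i j • X j‖ ≤ Fintype.card κ * (δ * n) := by
  have hδn : 0 ≤ δ * n := zero_le_one.trans h.one_le
  have hfiber : ∀ z ∈ (Finset.univ.image x).filter (· ∈ S),
      ‖∑ j ∈ Finset.univ.filter (X · ∈ S) with X j = z, edgeNoise X G i j • X j‖ ≤ δ * n := by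
    intro z hz
    simp only [Finset.mem_filter, Finset.mem_image, Finset.mem_univ, true_and] at hz
    obtain ⟨⟨k, rfl⟩, hkS⟩ := hz
    have hsum : ∑ j ∈ Finset.univ.filter (X · ∈ S) with X j = x k, edgeNoise X G i j • X j =
        (∑ j with X j = x k, edgeNoise X G i j) • x k := by
      rw [Finset.filter_filter, Finset.sum_smul]
      refine Finset.sum_congr (Finset.filter_congr fun j _ => ?_) fun j hj => ?_
      · exact ⟨And.right, fun hj => ⟨hj ▸ hkS, hj⟩⟩
      · rw [(Finset.mem_filter.1 hj).2]
    rw [hsum, norm_smul, Real.norm_eq_abs]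
    exact (mul_le_of_le_one_right (abs_nonneg _) (hx k)).trans (h.noise_sum i k)
  rw [← Finset.sum_fiberwise_of_maps_to (t := (Finset.univ.image x).filter (· ∈ S)) (g := X)
    fun j hj => Finset.mem_filter.2
      ⟨by simpa using h.mem_range j, (Finset.mem_filter.1 hj).2⟩]
  refine (norm_sum_le_of_le _ hfiber).trans ?_
  rw [Finset.sum_const, nsmul_eq_mul]
  gcongr
  exact (Finset.card_filter_le _ _).trans Finset.card_image_le

theorem mul_norm_sq_le_sum_inner_sq [Fintype V] (h : IsTypical x w δ X G)
    (hδ : 0 < δ) (hw : 0 < w) {C : Set κ} {e : V → Fin n} (he : Function.Injective e)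
    (hrange : Set.range e = {i | X i ∈ x '' C}) {l : ℝ} (hl : 0 < l)
    {v : EuclideanSpace ℝ ι}
    (hlv : ∀ t : ℝ, 0 ≤ t → (∀ y ∈ x '' C, |inner ℝ y v| ≤ t) → l * ‖v‖ ≤ t) :
    l ^ 2 * w * n * ‖v‖ ^ 2 ≤ ∑ a, inner ℝ (X (e a)) v ^ 2 := by
  classical
  have hn := h.natCast_pos hδ
  set T := ∑ a, inner ℝ (X (e a)) v ^ 2
  have hy : ∀ y ∈ x '' C, |inner ℝ y v| ≤ Real.sqrt (T / (w * n)) := by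
    rintro _ ⟨k, hk, rfl⟩
    refine Real.le_sqrt_of_sq_le ((le_div_iff₀' (by positivity)).2 ?_)
    calc w * n * |inner ℝ (x k) v| ^ 2
        ≤ (Finset.univ.filter fun i => X i = x k).card * inner ℝ (x k) v ^ 2 := by
          rw [sq_abs]; gcongr; exact h.le_count k
      _ = ∑ i with X i = x k, inner ℝ (X i) v ^ 2 := by
          rw [Finset.sum_congr rfl fun i hi => by rw [(Finset.mem_filter.1 hi).2],
            Finset.sum_const, nsmul_eq_mul]
      _ ≤ ∑ i ∈ Finset.univ.map ⟨e, he⟩, inner ℝ (X i) v ^ 2 := by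
          refine Finset.sum_le_sum_of_subset_of_nonneg (fun i hi => ?_) fun _ _ _ => sq_nonneg _
          have hi' : i ∈ Set.range e := hrange.ge ⟨k, hk, (Finset.mem_filter.1 hi).2.symm⟩
          simpa using hi'
      _ = T := Finset.sum_map _ _ _
  have : 0 ≤ T := Finset.sum_nonneg fun _ _ => sq_nonneg _
  have hsq := pow_le_pow_left₀ (by positivity) (hlv _ (Real.sqrt_nonneg _) hy) 2
  rw [Real.sq_sqrt (by positivity), le_div_iff₀ (by positivity)] at hsq
  linarith

theorem abs_inner_sub_inner_le [Fintype κ] [Fintype V] [DecidableEq V]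
    (h : IsTypical x w δ X G) (hδ : 0 < δ) (hw : 0 < w)
    (hx : ∀ k l, inner ℝ (x k) (x l) ∈ Set.Icc (0 : ℝ) 1) {C : Set κ}
    (hm : Module.finrank ℝ (Submodule.span ℝ (x '' C)) = m) {l : ℝ} (hl : 0 < l)
    (hframe : ∀ v ∈ Submodule.span ℝ (x '' C), ∀ t : ℝ, 0 ≤ t →
      (∀ y ∈ x '' C, |inner ℝ y v| ≤ t) → l * ‖v‖ ≤ t)
    {θ : ℝ} (hθ : 0 < θ) (hθl : θ ≤ l ^ 2 * w / 4) (hδθ : 2 * δ ≤ θ ^ 2)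
    (hκδ : Fintype.card κ * δ ≤ θ) {e : V → Fin n} (he : Function.Injective e)
    (hrange : Set.range e = {i | X i ∈ x '' C}) {Xhat : V → EuclideanSpace ℝ (Fin m)}
    (hASE : IsASE ((adjacency G).submatrix e e) Xhat) (a b : V) :
    |inner ℝ (Xhat a) (Xhat b) - inner ℝ (X (e a)) (X (e b))| ≤
      (8 / (l ^ 2 * w) ^ 2 + 3 / (l ^ 2 * w)) * θ := by
  classical
  have hn := h.natCast_pos hδ
  have hmem : ∀ a, X (e a) ∈ x '' C := fun a => hrange.le ⟨a, rfl⟩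
  have hnorm : ∀ k, ‖x k‖ ≤ 1 := fun k => by
    rw [← sq_le_one_iff₀ (norm_nonneg _), ← real_inner_self_eq_norm_sq]
    exact (hx k k).2
  let Y : V → Submodule.span ℝ (x '' C) := fun a => ⟨X (e a), Submodule.subset_span (hmem a)⟩
  have hnoise : (adjacency G).submatrix e e - Matrix.gram ℝ Y = (edgeNoise X G).submatrix e e :=
    rfl
  refine hASE.abs_inner_sub_inner_le hm ((isSymm_adjacency G).submatrix e) (Y := Y) hn
    (by positivity) hθl (fun v => h.mul_norm_sq_le_sum_inner_sq hδ hw he hrange hl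
      (hframe v v.2)) (fun a => ?_) (fun a => ?_)
    (hnoise ▸ h.norm_toEuclideanCLM_edgeNoise_le hx he hθ.le hδθ) (fun a => ?_) a b
  · obtain ⟨k, -, hk⟩ := hmem a
    exact (congrArg norm hk).symm.trans_le (hnorm k)
  · refine (Finset.sum_le_card_nsmul _ _ 1 fun b _ =>
      pow_le_one₀ (adjacency_mem_Icc G _ _).1 (adjacency_mem_Icc G _ _).2).trans ?_
    simpa using Fintype.card_le_of_injective e he
  · have hsum : ((∑ b, ((adjacency G).submatrix e e a b - inner ℝ (Y a) (Y b)) • Y b :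
        Submodule.span ℝ (x '' C)) : EuclideanSpace ℝ ι) =
        ∑ j with X j ∈ x '' C, edgeNoise X G (e a) j • X j := by
      have himage : Finset.univ.filter (X · ∈ x '' C) = Finset.univ.map ⟨e, he⟩ := by
        ext j
        simpa using (Set.ext_iff.1 hrange j).symm
      rw [himage, Finset.sum_map]
      push_cast
      rfl
    refine (congrArg norm hsum).trans_le ((h.norm_sum_edgeNoise_smul_le hnorm _ _).trans ?_)
    rw [← mul_assoc]
    gcongr

end IsTypical

theorem eventually_isTypical_abs_inner_sub_inner_le {κ ι : Type*} [Finite κ] [Fintype ι]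
    {m : ℕ} {x : κ → EuclideanSpace ℝ ι} (hx : ∀ k l, inner ℝ (x k) (x l) ∈ Set.Icc (0 : ℝ) 1)
    {C : Set κ} (hm : Module.finrank ℝ (Submodule.span ℝ (x '' C)) = m) {w ε : ℝ} (hw : 0 < w)
    (hε : 0 < ε) :
    ∀ᶠ δ in 𝓝[>] (0 : ℝ), ∀ {n : ℕ} {X : Fin n → EuclideanSpace ℝ ι} {G : SimpleGraph (Fin n)},
      IsTypical x w δ X G → ∀ {V : Type*} [Fintype V] [DecidableEq V] {e : V → Fin n},
      Function.Injective e → Set.range e = {i | X i ∈ x '' C} →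
      ∀ {Xhat : V → EuclideanSpace ℝ (Fin m)}, IsASE ((adjacency G).submatrix e e) Xhat →
      ∀ a b, |inner ℝ (Xhat a) (Xhat b) - inner ℝ (X (e a)) (X (e b))| ≤ ε := by
  classical
  cases nonempty_fintype κ
  obtain ⟨l, hl, hframe⟩ := exists_frame_bound ((Set.toFinite C).image x)
  set c := 8 / (l ^ 2 * w) ^ 2 + 3 / (l ^ 2 * w)
  have hc : 0 < c := by positivity
  set θ := min (l ^ 2 * w / 4) (ε / c)
  have hθ : 0 < θ := by positivity
  have hsmall : ∀ (c : ℝ) {b : ℝ}, 0 < b → ∀ᶠ δ in 𝓝[>] (0 : ℝ), c * δ ≤ b := fun c b hb =>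
    nhdsWithin_le_nhds (((continuous_const_mul c).tendsto' 0 0 (mul_zero c)).eventually_le_const hb)
  filter_upwards [hsmall 2 (pow_pos hθ 2), hsmall (Fintype.card κ) hθ, self_mem_nhdsWithin]
    with δ hδθ hκδ hδ n X G h V _ _ e he hrange Xhat hASE a b
  refine (h.abs_inner_sub_inner_le hδ hw hx hm hl hframe hθ (min_le_left _ _) hδθ hκδ he hrange
    hASE a b).trans ?_
  calc c * θ ≤ c * (ε / c) := by gcongr; exact min_le_right _ _
    _ = ε := by field_simp

end Typical

section Concentration

variable {Ω κ : Type*} [MeasurableSpace Ω] {μ : Measure Ω}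

theorem hasSubgaussianMGF_of_le {Z : Ω → ℝ} {c c' : NNReal} (h : HasSubgaussianMGF Z c μ)
    (hc : c ≤ c') : HasSubgaussianMGF Z c' μ where
  integrable_exp_mul := h.integrable_exp_mul
  mgf_le t := (h.mgf_le t).trans (by gcongr)

theorem hasSubgaussianMGF_one_of_abs_le_one [IsProbabilityMeasure μ] {Z : Ω → ℝ}
    (hm : Measurable Z) (hb : ∀ ω, |Z ω| ≤ 1) (h0 : ∫ ω, Z ω ∂μ = 0) :
    HasSubgaussianMGF Z 1 μ := by
  convert hasSubgaussianMGF_of_mem_Icc_of_integral_eq_zero (a := -1) (b := 1) hm.aemeasurable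
    (Filter.Eventually.of_forall fun ω => abs_le.1 (hb ω)) h0 using 1
  ext
  norm_num

theorem measureReal_abs_ge_le_of_hasSubgaussianMGF [IsFiniteMeasure μ] {Z : Ω → ℝ} {c : NNReal}
    (h : HasSubgaussianMGF Z c μ) {t : ℝ} (ht : 0 ≤ t) :
    μ.real {ω | t ≤ |Z ω|} ≤ 2 * Real.exp (-t ^ 2 / (2 * c)) := by
  have hsub : {ω | t ≤ |Z ω|} ⊆ {ω | t ≤ Z ω} ∪ {ω | t ≤ (-Z) ω} :=
    fun ω (hω : t ≤ |Z ω|) => le_abs.1 hω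
  calc μ.real {ω | t ≤ |Z ω|}
      ≤ μ.real {ω | t ≤ Z ω} + μ.real {ω | t ≤ (-Z) ω} :=
        (measureReal_mono hsub).trans (measureReal_union_le _ _)
    _ ≤ 2 * Real.exp (-t ^ 2 / (2 * c)) := by
        rw [two_mul]
        exact add_le_add (h.measure_ge_le ht) (h.neg.measure_ge_le ht)

theorem measureReal_lt_abs_le_of_abs_le_two_add [IsFiniteMeasure μ] {Y Z : Ω → ℝ} {c : NNReal}
    (hZ : HasSubgaussianMGF Z c μ) (hYZ : ∀ ω, |Y ω| ≤ 2 + |Z ω|) {δ : ℝ} {n : ℕ}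
    (hc : c ≤ n) (hn : 4 ≤ δ * n) :
    μ.real {ω | δ * n < |Y ω|} ≤ 2 * Real.exp (-(δ ^ 2 / 8) * n) := by
  have hn' : (n : ℝ) ≠ 0 := fun h => by norm_num [h] at hn
  calc μ.real {ω | δ * n < |Y ω|}
      ≤ μ.real {ω | δ * n / 2 ≤ |Z ω|} :=
        measureReal_mono fun ω (hω : δ * n < |Y ω|) =>
          show δ * n / 2 ≤ |Z ω| by linarith [hYZ ω]
    _ ≤ 2 * Real.exp (-(δ * n / 2) ^ 2 / (2 * (n : NNReal))) :=
        measureReal_abs_ge_le_of_hasSubgaussianMGF (hasSubgaussianMGF_of_le hZ hc) (by linarith)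
    _ = 2 * Real.exp (-(δ ^ 2 / 8) * n) := by
        rw [NNReal.coe_natCast]
        congr 2
        field

theorem indepFun_mul_sum_mul {Z W : κ → Ω → ℝ} (hind : iIndepFun (Sum.elim Z W) μ)
    (hZ : ∀ k, Measurable (Z k)) (hW : ∀ k, Measurable (W k)) {k : κ} {s : Finset κ}
    (hk : k ∉ s) :
    IndepFun (fun ω => Z k ω * W k ω) (fun ω => ∑ l ∈ s, Z l ω * W l ω) μ := by
  classical
  have hdisj : Disjoint (({k} : Finset κ).disjSum {k}) (s.disjSum s) := by
    rw [Finset.disjoint_left]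
    rintro (l | l) hl hls <;> simp_all
  have hblocks := hind.indepFun_finset _ _ hdisj (Sum.rec hZ hW)
  let f : (({k} : Finset κ).disjSum {k} → ℝ) → ℝ := fun v =>
    v ⟨Sum.inl k, by simp⟩ * v ⟨Sum.inr k, by simp⟩
  let g : (s.disjSum s → ℝ) → ℝ := fun v =>
    ∑ l : s, v ⟨Sum.inl l, by simp⟩ * v ⟨Sum.inr l, by simp⟩
  have hg : (fun ω => ∑ l ∈ s, Z l ω * W l ω) = g ∘ fun ω l => Sum.elim Z W l ω :=
    funext fun ω => (Finset.sum_coe_sort s fun l => Z l ω * W l ω).symm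
  rw [hg]
  exact hblocks.comp (φ := f) (by fun_prop) (by fun_prop)

theorem hasSubgaussianMGF_sum_mul [IsProbabilityMeasure μ] {Z W : κ → Ω → ℝ}
    (hind : iIndepFun (Sum.elim Z W) μ)
    (hZ : ∀ k, Measurable (Z k)) (hW : ∀ k, Measurable (W k))
    (hZb : ∀ k ω, |Z k ω| ≤ 1) (hWb : ∀ k ω, |W k ω| ≤ 1) (hZ0 : ∀ k, ∫ ω, Z k ω ∂μ = 0)
    (s : Finset κ) : HasSubgaussianMGF (fun ω => ∑ k ∈ s, Z k ω * W k ω) s.card μ := by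
  classical
  have hterm : ∀ k, HasSubgaussianMGF (fun ω => Z k ω * W k ω) 1 μ := fun k => by
    refine hasSubgaussianMGF_one_of_abs_le_one ((hZ k).mul (hW k)) (fun ω => ?_) ?_
    · rw [abs_mul]
      exact mul_le_one₀ (hZb k ω) (abs_nonneg _) (hWb k ω)
    · have hkk : IndepFun (Z k) (W k) μ := hind.indepFun (i := Sum.inl k) (j := Sum.inr k) (by simp)
      rw [hkk.integral_fun_mul_eq_mul_integral (hZ k).aestronglyMeasurable
        (hW k).aestronglyMeasurable, hZ0, zero_mul]
  induction s using Finset.induction_on with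
  | empty => simp
  | insert k s hk ih =>
    simpa [Finset.sum_insert hk, Finset.card_insert_of_notMem hk, add_comm] using
      (hterm k).add_of_indepFun ih (indepFun_mul_sum_mul hind hZ hW hk)

end Concentration

section Coins

variable {ε : Type*}

/-- The outcome of the coin `e`, which shows heads with probability `P e`, minus its mean. -/
noncomputable def coinNoise (P : ε → unitInterval) (e : ε) (ω : ε → Bool) : ℝ :=
  (if ω e then 1 else 0) - P e

theorem measurable_coinNoise (P : ε → unitInterval) (e : ε) : Measurable (coinNoise P e) :=
  (measurable_of_finite fun b : Bool => (if b then (1 : ℝ) else 0) - P e).comp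
    (measurable_pi_apply e)

theorem abs_coinNoise_le_one (P : ε → unitInterval) (e : ε) (ω : ε → Bool) :
    |coinNoise P e ω| ≤ 1 := by
  obtain ⟨h₀, h₁⟩ := (P e).2
  rw [coinNoise, abs_le]
  split_ifs <;> constructor <;> linarith

variable [Fintype ε]

/-- The law of independent coins with success probabilities `P`. -/
noncomputable def coinMeasure (P : ε → unitInterval) : Measure (ε → Bool) :=
  Measure.pi fun e => bernoulliMeasure true false (P e)

instance (P : ε → unitInterval) : IsProbabilityMeasure (coinMeasure P) := by
  unfold coinMeasure
  infer_instance

variable (P : ε → unitInterval)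

theorem iIndepFun_coinNoise : iIndepFun (coinNoise P) (coinMeasure P) :=
  iIndepFun_pi (μ := fun e => bernoulliMeasure true false (P e))
    (X := fun e (b : Bool) => (if b then (1 : ℝ) else 0) - P e)
    fun _ => (measurable_of_finite _).aemeasurable

theorem integral_coinNoise (e : ε) : ∫ ω, coinNoise P e ω ∂coinMeasure P = 0 := by
  refine (integral_comp_eval (μ := fun e => bernoulliMeasure true false (P e)) (i := e)
    (f := fun b : Bool => (if b then (1 : ℝ) else 0) - P e)
    (measurable_of_finite _).aestronglyMeasurable).trans ?_
  rw [integral_bernoulliMeasure]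
  simp
  ring

variable {κ : Type*}

theorem hasSubgaussianMGF_sum_coinNoise {a : κ → ε} (ha : Function.Injective a) (s : Finset κ) :
    HasSubgaussianMGF (fun ω => ∑ k ∈ s, coinNoise P (a k) ω) s.card (coinMeasure P) := by
  simpa using HasSubgaussianMGF.sum_of_iIndepFun ((iIndepFun_coinNoise P).precomp ha)
    (c := fun _ => 1) (s := s) fun k _ => hasSubgaussianMGF_one_of_abs_le_one
      (measurable_coinNoise P _) (abs_coinNoise_le_one P _) (integral_coinNoise P _)

theorem hasSubgaussianMGF_sum_coinNoise_mul {a b : κ → ε}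
    (hab : Function.Injective (Sum.elim a b)) (s : Finset κ) :
    HasSubgaussianMGF (fun ω => ∑ k ∈ s, coinNoise P (a k) ω * coinNoise P (b k) ω) s.card
      (coinMeasure P) := by
  have hind : iIndepFun (Sum.elim (fun k => coinNoise P (a k)) fun k => coinNoise P (b k))
      (coinMeasure P) := by
    convert (iIndepFun_coinNoise P).precomp hab using 1
    ext (k | k) <;> rfl
  exact hasSubgaussianMGF_sum_mul hind (fun _ => measurable_coinNoise P _)
    (fun _ => measurable_coinNoise P _) (fun _ => abs_coinNoise_le_one P _)
    (fun _ => abs_coinNoise_le_one P _) (fun _ => integral_coinNoise P _) s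

theorem bernoulliMeasure_setOf_iff (p : unitInterval) (q : Prop) [Decidable q] :
    bernoulliMeasure true false p {b | b = true ↔ q} =
      ENNReal.ofReal (if q then (p : ℝ) else 1 - p) := by
  split_ifs with hq
  · rw [bernoulliMeasure_apply_of_mem_of_notMem _ (by measurability) (by simp [hq])
      (by simp [hq]), ENNReal.ofReal]
    congr 1
    ext
    simp [p.2.1]
  · rw [bernoulliMeasure_apply_of_notMem_of_mem _ (by measurability) (by simp [hq])
      (by simp [hq]), ENNReal.ofReal]
    congr 1
    ext
    simp [p.2.2]

end Coins

section GraphLaw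

variable {n : ℕ}

/-- The index of the coin that decides about the edge `ij` of a random graph: the pair with its
larger entry first. -/
def orderedPair (i j : Fin n) : Fin n × Fin n := (max i j, min i j)

theorem orderedPair_comm (i j : Fin n) : orderedPair i j = orderedPair j i := by
  rw [orderedPair, orderedPair, max_comm, min_comm]

theorem orderedPair_of_lt {i j : Fin n} (h : j < i) : orderedPair i j = (i, j) := by
  rw [orderedPair, max_eq_left h.le, min_eq_right h.le]

theorem orderedPair_eq_iff {i j k l : Fin n} :
    orderedPair i j = orderedPair k l ↔ (i = k ∧ j = l) ∨ (i = l ∧ j = k) := by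
  grind [orderedPair]

theorem orderedPair_right_injective (i : Fin n) : Function.Injective (orderedPair i) := by
  intro k l hkl
  rcases orderedPair_eq_iff.1 hkl with h | h
  · exact h.2
  · exact h.2.trans h.1

/-- The random graph whose edges are decided by the coins `ω`; only the coins `(i, j)` with `j < i`
are used. -/
def coinGraph (ω : Fin n × Fin n → Bool) : SimpleGraph (Fin n) where
  Adj i j := i ≠ j ∧ ω (orderedPair i j) = true
  symm := ⟨fun i j h => ⟨h.1.symm, by rw [orderedPair_comm]; exact h.2⟩⟩
  loopless := ⟨fun _ h => h.1 rfl⟩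

theorem coinGraph_eq_iff {ω : Fin n × Fin n → Bool} {G : SimpleGraph (Fin n)} :
    coinGraph ω = G ↔ ∀ i j, j < i → (ω (i, j) = true ↔ G.Adj i j) := by
  constructor
  · rintro rfl i j hij
    simp [coinGraph, orderedPair_of_lt hij, hij.ne']
  · intro h
    ext i j
    rcases lt_trichotomy i j with hij | rfl | hij
    · simp [coinGraph, orderedPair_comm i j, orderedPair_of_lt hij, hij.ne, h j i hij, G.adj_comm]
    · simp
    · simp [coinGraph, orderedPair_of_lt hij, hij.ne', h i j hij]

variable {ι : Type*} [Fintype ι] {x : Fin n → EuclideanSpace ℝ ι}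

/-- The edge probabilities `⟨x i, x j⟩` of a random dot product graph, as success probabilities of
coins. -/
noncomputable def edgeProbability (hx : ∀ i j, inner ℝ (x i) (x j) ∈ Set.Icc (0 : ℝ) 1)
    (e : Fin n × Fin n) : unitInterval :=
  ⟨inner ℝ (x e.1) (x e.2), hx e.1 e.2⟩

variable (hx : ∀ i j, inner ℝ (x i) (x j) ∈ Set.Icc (0 : ℝ) 1)

theorem edgeLikelihood_eq_prod (x : Fin n → EuclideanSpace ℝ ι) (G : SimpleGraph (Fin n))
    [DecidableRel G.Adj] :
    edgeLikelihood x G = ∏ e : Fin n × Fin n, if e.2 < e.1 then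
      if G.Adj e.1 e.2 then inner ℝ (x e.1) (x e.2) else 1 - inner ℝ (x e.1) (x e.2) else 1 := by
  simp only [edgeLikelihood, Fintype.prod_prod_type, Finset.prod_filter]
  congr!

theorem coinMeasure_coinGraph_eq (G : SimpleGraph (Fin n)) :
    coinMeasure (edgeProbability hx) {ω | coinGraph ω = G} =
      ENNReal.ofReal (edgeLikelihood x G) := by
  classical
  have hset : {ω : Fin n × Fin n → Bool | coinGraph ω = G} = Set.pi Set.univ
      fun e : Fin n × Fin n =>
        if e.2 < e.1 then {b | b = true ↔ G.Adj e.1 e.2} else Set.univ := by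
    ext ω
    simp only [Set.mem_ofPred_eq, coinGraph_eq_iff, Set.mem_univ_pi, Prod.forall]
    refine forall₂_congr fun i j => ?_
    split_ifs with hij <;> simp [hij]
  rw [hset, coinMeasure, Measure.pi_pi, edgeLikelihood_eq_prod, ENNReal.ofReal_prod_of_nonneg]
  · refine Finset.prod_congr rfl fun e _ => ?_
    by_cases hlt : e.2 < e.1
    · simp only [if_pos hlt]
      exact bernoulliMeasure_setOf_iff (edgeProbability hx e) (G.Adj e.1 e.2)
    · simp only [if_neg hlt]
      rw [measure_univ, ENNReal.ofReal_one]
  · intro e _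
    split_ifs
    · exact (hx e.1 e.2).1
    · exact sub_nonneg.2 (hx e.1 e.2).2
    · exact zero_le_one

theorem edgeNoise_coinGraph (ω : Fin n × Fin n → Bool) {i j : Fin n} (hij : i ≠ j) :
    edgeNoise x (coinGraph ω) i j = coinNoise (edgeProbability hx) (orderedPair i j) ω := by
  classical
  have hprob : (edgeProbability hx (orderedPair i j) : ℝ) = inner ℝ (x i) (x j) := by
    rcases hij.lt_or_gt with h | h
    · rw [orderedPair_comm, orderedPair_of_lt h]
      exact real_inner_comm _ _
    · rw [orderedPair_of_lt h]
      rfl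
  rw [edgeNoise, coinNoise, hprob, Matrix.sub_apply, Matrix.gram_apply, adjacency,
    SimpleGraph.adjMatrix_apply]
  simp [coinGraph, hij]

theorem abs_sum_le_card_add_abs_sum_sdiff {κ : Type*} [DecidableEq κ] {f : κ → ℝ} (s t : Finset κ)
    (hf : ∀ k, |f k| ≤ 1) : |∑ k ∈ s, f k| ≤ t.card + |∑ k ∈ s \ t, f k| := by
  have hcard : |∑ k ∈ s ∩ t, f k| ≤ t.card := calc
    |∑ k ∈ s ∩ t, f k| ≤ ∑ k ∈ s ∩ t, |f k| := Finset.abs_sum_le_sum_abs _ _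
    _ ≤ (s ∩ t).card := by simpa using Finset.sum_le_card_nsmul (s ∩ t) _ 1 fun k _ => hf k
    _ ≤ t.card := by exact_mod_cast Finset.card_le_card Finset.inter_subset_right
  rw [← Finset.sum_inter_add_sum_sdiff s t f]
  exact (abs_add_le _ _).trans (by gcongr)

theorem coinMeasure_real_lt_abs_sum_edgeNoise_mul_le {δ : ℝ} (hn : 4 ≤ δ * n) {i j : Fin n}
    (hij : i ≠ j) :
    (coinMeasure (edgeProbability hx)).real {ω | δ * n < |∑ k, edgeNoise x (coinGraph ω) k i *
      edgeNoise x (coinGraph ω) k j|} ≤ 2 * Real.exp (-(δ ^ 2 / 8) * n) := by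
  set s : Finset (Fin n) := Finset.univ \ {i, j}
  have hs : ∀ k : s, (k : Fin n) ≠ i ∧ (k : Fin n) ≠ j := fun k => by
    have := k.2
    simpa only [s, Finset.mem_sdiff, Finset.mem_univ, Finset.mem_insert, Finset.mem_singleton,
      true_and, not_or] using this
  have hinj : Function.Injective (Sum.elim (fun k : s => orderedPair (k : Fin n) i)
      fun k : s => orderedPair (k : Fin n) j) := by
    simp only [orderedPair_comm _ i, orderedPair_comm _ j]
    refine ((orderedPair_right_injective i).comp Subtype.val_injective).sumElim
      ((orderedPair_right_injective j).comp Subtype.val_injective) fun k l hkl => ?_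
    rcases orderedPair_eq_iff.1 hkl with h | h
    · exact hij h.1
    · exact (hs l).1 h.1.symm
  refine measureReal_lt_abs_le_of_abs_le_two_add
    (hasSubgaussianMGF_sum_coinNoise_mul (edgeProbability hx) hinj Finset.univ) (fun ω => ?_)
    (by simpa using s.card_le_univ) hn
  have hnoise : ∀ k, |edgeNoise x (coinGraph ω) k i * edgeNoise x (coinGraph ω) k j| ≤ 1 :=
    fun k => by
      rw [abs_mul]
      exact mul_le_one₀ (abs_edgeNoise_le_one (hx k i) _) (abs_nonneg _)
        (abs_edgeNoise_le_one (hx k j) _)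
  have hsum : ∑ k ∈ s, edgeNoise x (coinGraph ω) k i * edgeNoise x (coinGraph ω) k j =
      ∑ k : s, coinNoise (edgeProbability hx) (orderedPair k i) ω *
        coinNoise (edgeProbability hx) (orderedPair k j) ω := by
    rw [← Finset.sum_coe_sort s]
    refine Finset.sum_congr rfl fun k _ => ?_
    rw [edgeNoise_coinGraph hx ω (hs k).1, edgeNoise_coinGraph hx ω (hs k).2]
  have hdiag := abs_sum_le_card_add_abs_sum_sdiff Finset.univ {i, j} hnoise
  rwa [hsum, Finset.card_pair hij, Nat.cast_ofNat] at hdiag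

theorem coinMeasure_real_lt_abs_sum_edgeNoise_le {δ : ℝ} (hn : 4 ≤ δ * n) (i : Fin n)
    (s : Finset (Fin n)) :
    (coinMeasure (edgeProbability hx)).real {ω | δ * n < |∑ k ∈ s, edgeNoise x (coinGraph ω) i k|} ≤
      2 * Real.exp (-(δ ^ 2 / 8) * n) := by
  refine measureReal_lt_abs_le_of_abs_le_two_add
    (hasSubgaussianMGF_sum_coinNoise (edgeProbability hx) (orderedPair_right_injective i) (s \ {i}))
    (fun ω => ?_) (by exact_mod_cast (Finset.card_le_univ _).trans_eq (by simp)) hn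
  have hsum : ∑ k ∈ s \ {i}, edgeNoise x (coinGraph ω) i k =
      ∑ k ∈ s \ {i}, coinNoise (edgeProbability hx) (orderedPair i k) ω :=
    Finset.sum_congr rfl fun k hk => edgeNoise_coinGraph hx ω fun h => by simp [h] at hk
  have hdiag := abs_sum_le_card_add_abs_sum_sdiff s {i}
    fun k => abs_edgeNoise_le_one (hx i k) (coinGraph ω)
  rw [hsum, Finset.card_singleton, Nat.cast_one] at hdiag
  linarith

end GraphLaw

section Tails

variable {ι Ω : Type*} [Fintype ι] [MeasurableSpace Ω] {n : ℕ}
  {F : Measure (EuclideanSpace ℝ ι)} {μ : Measure Ω} {X : Fin n → Ω → EuclideanSpace ℝ ι}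
  {A : Ω → SimpleGraph (Fin n)}

theorem IsRDPG.measurableSet_positions_eq (h : IsRDPG F μ X A) (x : Fin n → EuclideanSpace ℝ ι) :
    MeasurableSet {ω | (fun i => X i ω) = x} :=
  measurable_pi_lambda _ h.measurable_position (measurableSet_singleton x)

theorem IsRDPG.measure_positions_eq_graph_eq (h : IsRDPG F μ X A)
    {x : Fin n → EuclideanSpace ℝ ι} (hx : ∀ i j, inner ℝ (x i) (x j) ∈ Set.Icc (0 : ℝ) 1)
    (G : SimpleGraph (Fin n)) :
    μ {ω | (fun i => X i ω) = x ∧ A ω = G} =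
      μ {ω | (fun i => X i ω) = x} * coinMeasure (edgeProbability hx) {ω | coinGraph ω = G} := by
  have hlaw := h.conditional_law {x} (measurableSet_singleton x) G
  simp only [Set.mem_singleton_iff] at hlaw
  rw [hlaw, coinMeasure_coinGraph_eq, mul_comm, ← setLIntegral_const]
  refine setLIntegral_congr_fun (h.measurableSet_positions_eq x) ?_
  rintro ω rfl
  rfl

theorem IsRDPG.measure_positions_eq_graph_mem (h : IsRDPG F μ X A)
    {x : Fin n → EuclideanSpace ℝ ι} (hx : ∀ i j, inner ℝ (x i) (x j) ∈ Set.Icc (0 : ℝ) 1)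
    (S : Set (SimpleGraph (Fin n))) :
    μ {ω | (fun i => X i ω) = x ∧ A ω ∈ S} =
      μ {ω | (fun i => X i ω) = x} * coinMeasure (edgeProbability hx) {ω | coinGraph ω ∈ S} := by
  have hX := h.measurableSet_positions_eq x
  lift S to Finset (SimpleGraph (Fin n)) using S.toFinite
  calc μ {ω | (fun i => X i ω) = x ∧ A ω ∈ (S : Set _)}
      = μ.restrict {ω | (fun i => X i ω) = x} (A ⁻¹' S) := by
        rw [Measure.restrict_apply' hX, Set.inter_comm]; rfl
    _ = ∑ G ∈ S, μ {ω | (fun i => X i ω) = x ∧ A ω = G} := by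
        rw [← sum_measure_preimage_singleton _ fun G _ => h.measurable_graph G]
        exact Finset.sum_congr rfl fun G _ => by
          rw [Measure.restrict_apply' hX, Set.inter_comm]; rfl
    _ = _ := by
        simp only [h.measure_positions_eq_graph_eq hx, ← Finset.mul_sum]
        rw [show {ω | coinGraph ω ∈ (S : Set (SimpleGraph (Fin n)))} = coinGraph ⁻¹' S from rfl,
          ← sum_measure_preimage_singleton _ fun G _ => (Set.toFinite _).measurableSet]
        rfl

variable [IsProbabilityMeasure μ]

theorem IsRDPG.measureReal_positions_mem_graph_mem_le (h : IsRDPG F μ X A)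
    {T : Set (EuclideanSpace ℝ ι)} (hfin : T.Finite)
    (hT : ∀ y ∈ T, ∀ z ∈ T, inner ℝ y z ∈ Set.Icc (0 : ℝ) 1)
    {S : (Fin n → EuclideanSpace ℝ ι) → Set (SimpleGraph (Fin n))} {b : ℝ}
    (hb : ∀ (x : Fin n → EuclideanSpace ℝ ι)
      (hx : ∀ i j, inner ℝ (x i) (x j) ∈ Set.Icc (0 : ℝ) 1),
      (coinMeasure (edgeProbability hx)).real {ω | coinGraph ω ∈ S x} ≤ b) :
    μ.real {ω | (∀ i, X i ω ∈ T) ∧ A ω ∈ S fun i => X i ω} ≤ b := by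
  classical
  set U : Finset (Fin n → EuclideanSpace ℝ ι) := Fintype.piFinset fun _ => hfin.toFinset
  have hU : ∀ y, y ∈ U ↔ ∀ i, y i ∈ T := fun y => by simp [U]
  have hpiece : ∀ x ∈ U, μ.real {ω | (fun i => X i ω) = x ∧ A ω ∈ S x} ≤
      μ.real {ω | (fun i => X i ω) = x} * b := fun x hxU => by
    have hxT := (hU x).1 hxU
    rw [measureReal_def, h.measure_positions_eq_graph_mem fun i j => hT _ (hxT i) _ (hxT j),
      ENNReal.toReal_mul]
    exact mul_le_mul_of_nonneg_left (hb x _) measureReal_nonneg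
  have hb0 : 0 ≤ b := measureReal_nonneg.trans (hb 0 fun i j => by simp)
  calc μ.real {ω | (∀ i, X i ω ∈ T) ∧ A ω ∈ S fun i => X i ω}
      ≤ μ.real (⋃ x ∈ U, {ω | (fun i => X i ω) = x ∧ A ω ∈ S x}) :=
        measureReal_mono (fun ω hω =>
          Set.mem_biUnion ((hU _).2 hω.1) ⟨rfl, hω.2⟩) (measure_ne_top _ _)
    _ ≤ ∑ x ∈ U, μ.real {ω | (fun i => X i ω) = x ∧ A ω ∈ S x} :=
        measureReal_biUnion_finset_le _ _
    _ ≤ (∑ x ∈ U, μ.real {ω | (fun i => X i ω) = x}) * b := by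
        rw [Finset.sum_mul]; exact Finset.sum_le_sum hpiece
    _ ≤ b := mul_le_of_le_one_left hb0 <|
        (sum_measureReal_preimage_singleton U fun x _ => h.measurableSet_positions_eq x).trans_le
          measureReal_le_one

theorem IsRDPG.measureReal_count_lt_le [DecidableEq (EuclideanSpace ℝ ι)] (h : IsRDPG F μ X A)
    {y : EuclideanSpace ℝ ι} {w : ℝ} (hw : 0 < w) (hF : w ≤ F.real {y}) (hn : 0 < n) :
    μ.real {ω | ((Finset.univ.filter fun i => X i ω = y).card : ℝ) < w / 2 * n} ≤
      Real.exp (-(w ^ 2 / 8) * n) := by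
  have : (0 : ℝ) < n := Nat.cast_pos.2 hn
  set p := F.real {y}
  have hlaw : ∀ i, μ.real (X i ⁻¹' {y}) = p := fun i => by
    rw [← map_measureReal_apply (h.measurable_position i) (measurableSet_singleton y), h.law i]
  have hp1 : p ≤ 1 := hlaw ⟨0, hn⟩ ▸ measureReal_le_one
  let g : EuclideanSpace ℝ ι → ℝ := fun z => p - Set.indicator {y} (fun _ => (1 : ℝ)) z
  have hg : Measurable g :=
    measurable_const.sub (measurable_const.indicator (measurableSet_singleton y))
  have hsub : ∀ i, HasSubgaussianMGF (fun ω => g (X i ω)) 1 μ := fun i => by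
    have hm : MeasurableSet (X i ⁻¹' {y}) := h.measurable_position i (measurableSet_singleton y)
    refine hasSubgaussianMGF_one_of_abs_le_one (hg.comp (h.measurable_position i))
      (fun ω => ?_) ?_
    · simp only [g, Set.indicator_apply, abs_le]
      split_ifs <;> constructor <;> linarith
    · rw [show (fun ω => g (X i ω)) = fun ω => p - (X i ⁻¹' {y}).indicator (fun _ => 1) ω from rfl,
        integral_sub (integrable_const _) ((integrable_const _).indicator hm),
        integral_indicator_const _ hm, hlaw i]
      simp
  have htail := HasSubgaussianMGF.measure_sum_ge_le_of_iIndepFun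
    (h.indep.comp (fun _ => g) fun _ => hg) (c := fun _ => 1) (s := Finset.univ)
    (fun i _ => hsub i) (ε := w / 2 * n) (by positivity)
  refine (measureReal_mono fun ω hω => ?_).trans (htail.trans (le_of_eq ?_))
  · have hsum : ∑ i, g (X i ω) = n * p - (Finset.univ.filter fun i => X i ω = y).card := by
      simp [g, Set.indicator_apply]
    rw [Set.mem_ofPred_eq] at hω
    change w / 2 * n ≤ ∑ i, g (X i ω)
    nlinarith
  · congr 1
    simp
    field_simp
    ring

end Tails

section AsympAlmostSurely

open Filter Topology

variable {Ω : ℕ → Type*} [∀ n, MeasurableSpace (Ω n)] {μ : ∀ n, Measure (Ω n)}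
  [∀ n, IsProbabilityMeasure (μ n)]

theorem AsympAlmostSurely.mono {E E' : ∀ n, Set (Ω n)} (h : AsympAlmostSurely μ E)
    (hE : ∀ n, E n ⊆ E' n) : AsympAlmostSurely μ E' := by
  intro c hc
  obtain ⟨n₀, h⟩ := h c hc
  exact ⟨n₀, fun n hn η hη hη' => (h n hn η hη hη').trans (measureReal_mono (hE n))⟩

theorem eventually_mul_sq_mul_exp_neg_mul_le_rpow_neg (C : ℝ) {b : ℝ} (hb : 0 < b) (c : ℝ) :
    ∀ᶠ n : ℕ in atTop, C * n ^ 2 * Real.exp (-b * n) ≤ (n : ℝ) ^ (-c) := by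
  have hlittle : (fun t : ℝ => C * (t ^ 2 * Real.exp (-b * t))) =o[atTop]
      fun t : ℝ => t ^ 2 * t ^ (-c - 2) :=
    ((Asymptotics.isBigO_refl _ _).mul_isLittleO
      (isLittleO_exp_neg_mul_rpow_atTop hb (-c - 2))).const_mul_left C
  filter_upwards [tendsto_natCast_atTop_atTop.eventually (hlittle.bound one_pos),
    eventually_gt_atTop 0] with n hbound hn
  have hn : (0 : ℝ) < n := Nat.cast_pos.2 hn
  calc C * n ^ 2 * Real.exp (-b * n) = C * (n ^ 2 * Real.exp (-b * n)) := mul_assoc _ _ _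
    _ ≤ 1 * ‖(n : ℝ) ^ 2 * (n : ℝ) ^ (-c - 2)‖ := (le_abs_self _).trans hbound
    _ = (n : ℝ) ^ (-c) := by
      rw [one_mul, Real.norm_of_nonneg (by positivity), ← Real.rpow_natCast, ← Real.rpow_add hn]
      norm_num

theorem AsympAlmostSurely.of_measureReal_compl_le {E : ∀ n, Set (Ω n)} {C b : ℝ} (hb : 0 < b)
    (h : ∀ᶠ n in atTop, (μ n).real (E n)ᶜ ≤ C * n ^ 2 * Real.exp (-b * n)) :
    AsympAlmostSurely μ E := by
  intro c _
  obtain ⟨n₀, hn₀⟩ := eventually_atTop.1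
    (h.and (eventually_mul_sq_mul_exp_neg_mul_le_rpow_neg C hb c))
  refine ⟨n₀, fun n hn η hη _ => ?_⟩
  have hcover : 1 ≤ (μ n).real (E n) + (μ n).real (E n)ᶜ := by
    rw [← probReal_univ (μ := μ n), ← Set.union_compl_self (E n)]
    exact measureReal_union_le _ _
  linarith [(hn₀ n hn.le).1, (hn₀ n hn.le).2]

end AsympAlmostSurely

section TypicalSamples

open Filter Topology

variable {κ ι : Type*} [Fintype ι] {x : κ → EuclideanSpace ℝ ι}
  {F : Measure (EuclideanSpace ℝ ι)} {w δ : ℝ}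

section FixedSize

variable {n : ℕ} {Ω : Type*} [MeasurableSpace Ω] {μ : Measure Ω}
  {X : Fin n → Ω → EuclideanSpace ℝ ι} {A : Ω → SimpleGraph (Fin n)}

theorem IsRDPG.measureReal_exists_notMem_eq_zero (h : IsRDPG F μ X A)
    {T : Set (EuclideanSpace ℝ ι)} (hT : MeasurableSet T) (hF : F Tᶜ = 0) :
    μ.real {ω | ∃ i, X i ω ∉ T} = 0 := by
  have hnull : ∀ i, μ {ω | X i ω ∉ T} = 0 := fun i => by
    rw [← h.law i, Measure.map_apply (h.measurable_position i) hT.compl] at hF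
    exact hF
  rw [Set.ofPred_exists, measureReal_def, measure_iUnion_null hnull, ENNReal.toReal_zero]

theorem measureReal_iUnion_le_card_mul {α : Type*} [Fintype α] {s : α → Set Ω} {b : ℝ}
    (hs : ∀ a, μ.real (s a) ≤ b) : μ.real (⋃ a, s a) ≤ Fintype.card α * b :=
  (measureReal_iUnion_fintype_le s).trans <|
    (Finset.sum_le_card_nsmul _ _ b fun a _ => hs a).trans_eq (nsmul_eq_mul _ _)

theorem IsRDPG.inner_mem_Icc (h : IsRDPG F μ X A) {y z : EuclideanSpace ℝ ι} (hy : F {y} ≠ 0)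
    (hz : F {z} ≠ 0) : inner ℝ y z ∈ Set.Icc (0 : ℝ) 1 := by
  obtain ⟨𝒳, hnull, h𝒳⟩ := h.admissible
  have hmem : ∀ {y}, F {y} ≠ 0 → y ∈ 𝒳 := fun hy => by
    by_contra hn
    exact hy (measure_mono_null (Set.singleton_subset_iff.2 hn) hnull)
  exact h𝒳 _ (hmem hy) _ (hmem hz)

variable [IsProbabilityMeasure μ]

theorem IsRDPG.measureReal_lt_abs_sum_edgeNoise_mul_le [Finite κ] (h : IsRDPG F μ X A)
    (hx : ∀ k l, inner ℝ (x k) (x l) ∈ Set.Icc (0 : ℝ) 1) (hn : 4 ≤ δ * n) (i j : Fin n) :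
    μ.real {ω | (∀ i, X i ω ∈ Set.range x) ∧ i ≠ j ∧
      δ * n < |∑ k, edgeNoise (fun i => X i ω) (A ω) k i * edgeNoise (fun i => X i ω) (A ω) k j|} ≤
      2 * Real.exp (-(δ ^ 2 / 8) * n) := by
  refine h.measureReal_positions_mem_graph_mem_le (Set.finite_range x) (by simpa using hx)
    (S := fun y => {G | i ≠ j ∧ δ * n < |∑ k, edgeNoise y G k i * edgeNoise y G k j|})
    fun y hy => ?_
  by_cases hij : i = j
  · suffices 0 ≤ 2 * Real.exp (-(δ ^ 2 / 8) * n) by simpa [hij] using this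
    positivity
  · exact (measureReal_mono fun ω hω => hω.2).trans
      (coinMeasure_real_lt_abs_sum_edgeNoise_mul_le hy hn hij)

open scoped Classical in
theorem IsRDPG.measureReal_lt_abs_sum_edgeNoise_le [Finite κ] (h : IsRDPG F μ X A)
    (hx : ∀ k l, inner ℝ (x k) (x l) ∈ Set.Icc (0 : ℝ) 1) (hn : 4 ≤ δ * n) (i : Fin n) (k : κ) :
    μ.real {ω | (∀ i, X i ω ∈ Set.range x) ∧
      δ * n < |∑ j with X j ω = x k, edgeNoise (fun i => X i ω) (A ω) i j|} ≤
      2 * Real.exp (-(δ ^ 2 / 8) * n) :=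
  h.measureReal_positions_mem_graph_mem_le (Set.finite_range x) (by simpa using hx)
    (S := fun y => {G | δ * n < |∑ j with y j = x k, edgeNoise y G i j|})
    fun _ hy => coinMeasure_real_lt_abs_sum_edgeNoise_le hy hn i _

theorem IsRDPG.measureReal_compl_isTypical_le [Fintype κ] (h : IsRDPG F μ X A)
    (hx : ∀ k l, inner ℝ (x k) (x l) ∈ Set.Icc (0 : ℝ) 1) (hF : F (Set.range x)ᶜ = 0)
    (hw : 0 < w) (hwF : ∀ k, w ≤ F.real {x k}) (hn : 4 ≤ δ * n) :
    μ.real {ω | IsTypical x (w / 2) δ (fun i => X i ω) (A ω)}ᶜ ≤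
      (3 * Fintype.card κ + 2) * n ^ 2 * Real.exp (-min (w ^ 2 / 8) (δ ^ 2 / 8) * n) := by
  classical
  set e := Real.exp (-min (w ^ 2 / 8) (δ ^ 2 / 8) * n)
  have hn0 : 0 < n := Nat.pos_of_ne_zero fun h0 => by norm_num [h0] at hn
  have hwe : Real.exp (-(w ^ 2 / 8) * n) ≤ e :=
    Real.exp_le_exp.2 (by gcongr; exact min_le_left _ _)
  have hδe : 2 * Real.exp (-(δ ^ 2 / 8) * n) ≤ 2 * e :=
    mul_le_mul_of_nonneg_left (Real.exp_le_exp.2 (by gcongr; exact min_le_right _ _)) zero_le_two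
  have hrange : μ.real {ω | ∃ i, X i ω ∉ Set.range x} = 0 :=
    h.measureReal_exists_notMem_eq_zero (Set.finite_range x).measurableSet hF
  have hcount := measureReal_iUnion_le_card_mul fun k =>
    (h.measureReal_count_lt_le hw (hwF k) hn0).trans hwe
  have hmul := measureReal_iUnion_le_card_mul fun p : Fin n × Fin n =>
    (h.measureReal_lt_abs_sum_edgeNoise_mul_le hx hn p.1 p.2).trans hδe
  have hsum := measureReal_iUnion_le_card_mul fun p : Fin n × κ =>
    (h.measureReal_lt_abs_sum_edgeNoise_le hx hn p.1 p.2).trans hδe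
  refine (measureReal_mono fun ω hω => ?_).trans <| (measureReal_union_le _ _).trans <|
    (add_le_add hrange.le <| (measureReal_union_le _ _).trans <| add_le_add hcount <|
      (measureReal_union_le _ _).trans <| add_le_add hmul hsum).trans ?_
  · contrapose! hω
    simp only [Set.mem_union, Set.mem_iUnion, Set.mem_ofPred_eq, not_or, not_exists, not_and,
      not_lt, not_not] at hω
    obtain ⟨hX, hcount, hmul, hsum⟩ := hω
    rw [Set.mem_compl_iff, not_not]
    exact ⟨by linarith, hX, hcount, fun i j => hmul (i, j) hX, fun i k => hsum (i, k) hX⟩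
  · have hn1 : (1 : ℝ) ≤ n := by exact_mod_cast hn0
    simp only [Fintype.card_prod, Fintype.card_fin, Nat.cast_mul, zero_add]
    calc (Fintype.card κ * e + (n * n * (2 * e) + n * Fintype.card κ * (2 * e)) : ℝ)
        = (Fintype.card κ * (1 + 2 * n) + 2 * n ^ 2) * e := by ring
      _ ≤ (Fintype.card κ * (3 * n ^ 2) + 2 * n ^ 2) * e := by
        gcongr
        nlinarith
      _ = _ := by ring

end FixedSize

theorem exists_pos_forall_le {κ : Type*} [Finite κ] {f : κ → ℝ} (hf : ∀ k, 0 < f k) :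
    ∃ m : ℝ, 0 < m ∧ ∀ k, m ≤ f k := by
  rcases isEmpty_or_nonempty κ with _ | _
  · exact ⟨1, one_pos, isEmptyElim⟩
  · obtain ⟨k, hk⟩ := Finite.exists_min f
    exact ⟨f k, hf k, hk⟩

variable {Ω : ℕ → Type*} [∀ n, MeasurableSpace (Ω n)] {μ : ∀ n, Measure (Ω n)}
  [∀ n, IsProbabilityMeasure (μ n)] {X : ∀ n, Fin n → Ω n → EuclideanSpace ℝ ι}
  {A : ∀ n, Ω n → SimpleGraph (Fin n)}

theorem asympAlmostSurely_isTypical [Finite κ]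
    (hx : ∀ k l, inner ℝ (x k) (x l) ∈ Set.Icc (0 : ℝ) 1) (hF : F (Set.range x)ᶜ = 0)
    (hw : 0 < w) (hwF : ∀ k, w ≤ F.real {x k}) (hδ : 0 < δ)
    (h : ∀ n, IsRDPG F (μ n) (X n) (A n)) :
    AsympAlmostSurely μ
      fun n => {ω | IsTypical x (w / 2) δ (fun i => X n i ω) (A n ω)} := by
  cases nonempty_fintype κ
  refine .of_measureReal_compl_le (C := 3 * Fintype.card κ + 2)
    (b := min (w ^ 2 / 8) (δ ^ 2 / 8)) (by positivity) ?_
  filter_upwards [(tendsto_natCast_atTop_atTop.const_mul_atTop hδ).eventually_ge_atTop 4]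
    with n hn using (h n).measureReal_compl_isTypical_le hx hF hw hwF hn

theorem asympAlmostSurely_of_eventually_isTypical [Finite κ] (hF : F (Set.range x)ᶜ = 0)
    (hatom : ∀ k, F {x k} ≠ 0) (h : ∀ n, IsRDPG F (μ n) (X n) (A n))
    {E : ∀ n, Set (Ω n)} (hE : ∀ w, 0 < w → ∀ᶠ δ in 𝓝[>] (0 : ℝ), ∀ n ω,
      IsTypical x w δ (fun i => X n i ω) (A n ω) → ω ∈ E n) :
    AsympAlmostSurely μ E := by
  have : IsProbabilityMeasure F :=
    (h 1).law 0 ▸ Measure.isProbabilityMeasure_map ((h 1).measurable_position 0).aemeasurable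
  obtain ⟨w, hw, hwF⟩ := exists_pos_forall_le fun k =>
    ENNReal.toReal_pos (hatom k) (measure_ne_top F {x k})
  obtain ⟨δ, hδE, hδ⟩ := ((hE (w / 2) (half_pos hw)).and self_mem_nhdsWithin).exists
  have hx : ∀ k l, inner ℝ (x k) (x l) ∈ Set.Icc (0 : ℝ) 1 := fun k l =>
    (h 0).inner_mem_Icc (hatom k) (hatom l)
  exact (asympAlmostSurely_isTypical hx hF hw hwF hδ h).mono fun n ω hω => hδE n ω hω

end TypicalSamples

section LinearSpan

variable {α E : Type*} [Fintype α] [AddCommGroup E] [Module ℝ E] [FiniteDimensional ℝ E]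

theorem finrank_iSup_le_sum (W : α → Submodule ℝ E) :
    Module.finrank ℝ (⨆ a, W a : Submodule ℝ E) ≤ ∑ a, Module.finrank ℝ (W a) := by
  classical
  rw [Submodule.iSup_eq_range_dfinsupp_lsum, ← Module.finrank_directSum]
  exact LinearMap.finrank_range_le _

theorem finrank_eq_of_iSup_eq_top {d : ℕ} {W : α → Submodule ℝ E} (hW : ⨆ a, W a = ⊤)
    (hE : Module.finrank ℝ E = Fintype.card α * d) (hd : ∀ a, Module.finrank ℝ (W a) ≤ d) (a : α) :
    Module.finrank ℝ (W a) = d := by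
  refine (hd a).antisymm (not_lt.1 fun hlt => ?_)
  have hle := finrank_iSup_le_sum W
  rw [hW, finrank_top, hE, ← smul_eq_mul, ← Finset.card_univ, ← Finset.sum_const] at hle
  exact hle.not_gt (Finset.sum_lt_sum (fun b _ => hd b) ⟨a, Finset.mem_univ a, hlt⟩)

variable {ι : Type*} [Fintype ι] {F : Measure (EuclideanSpace ℝ ι)} {S : Set (EuclideanSpace ℝ ι)}

theorem secondMoment_mulVec_eq_zero (hF : ∀ a b, Integrable (fun y => y a * y b) F)
    {v : EuclideanSpace ℝ ι} (hv : ∀ᵐ y ∂F, inner ℝ y v = 0) :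
    (secondMoment F).mulVec v = 0 := by
  ext a
  calc ∑ b, (∫ y, y a * y b ∂F) * v b = ∑ b, ∫ y, y a * y b * v b ∂F := by
        simp only [integral_mul_const]
    _ = ∫ y, y a * inner ℝ y v ∂F := by
        rw [← integral_finsetSum _ fun b _ => (hF a b).mul_const _]
        simp only [PiLp.inner_apply, real_inner_eq_re_inner, Finset.mul_sum]
        simp [mul_comm, mul_left_comm]
    _ = 0 := integral_eq_zero_of_ae (hv.mono fun y hy => by simp [hy])

theorem span_eq_top_of_rank_secondMoment (hF : ∀ a b, Integrable (fun y => y a * y b) F)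
    (hS : F Sᶜ = 0) (hrank : (secondMoment F).rank = Fintype.card ι) :
    Submodule.span ℝ S = ⊤ := by
  have hinj : Function.Injective (secondMoment F).mulVecLin := by
    rw [LinearMap.injective_iff_surjective, ← LinearMap.range_eq_top]
    exact Submodule.eq_top_of_finrank_eq (hrank.trans (by simp))
  rw [← Submodule.orthogonal_eq_bot_iff, Submodule.eq_bot_iff]
  intro v hv
  have hker : (secondMoment F).mulVecLin v.ofLp = 0 :=
    secondMoment_mulVec_eq_zero hF <|
      (show ∀ᵐ y ∂F, y ∈ S from mem_ae_iff.2 hS).mono fun y hy =>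
        (Submodule.mem_orthogonal _ v).1 hv y (Submodule.subset_span hy)
  exact WithLp.ofLp_injective 2 (hinj (hker.trans (map_zero _).symm))

end LinearSpan

section BlockModel

variable {R K : ℕ} {ι : Type*} [Fintype ι] {π : Fin R → ℝ} {πs : Fin R → Fin K → ℝ}
  {x : Fin R → Fin K → EuclideanSpace ℝ ι}

theorem hsbmLaw_singleton_ne_zero (hπ : ∀ r, 0 < π r) (hπs : ∀ r k, 0 < πs r k) (r : Fin R)
    (k : Fin K) : hsbmLaw π πs x {x r k} ≠ 0 := by
  have hmass : 0 < ENNReal.ofReal (π r) * (ENNReal.ofReal (πs r k) *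
      Measure.dirac (x r k) {x r k}) := by
    simp [hπ r, hπs r k]
  refine (hmass.trans_le ?_).ne'
  simp only [hsbmLaw, Measure.finsetSum_apply, Measure.smul_apply, smul_eq_mul]
  refine le_trans ?_ (Finset.single_le_sum (fun _ _ => zero_le) (Finset.mem_univ r))
  gcongr
  exact Finset.single_le_sum (f := fun l => ENNReal.ofReal (πs r l) * Measure.dirac (x r l) {x r k})
    (fun _ _ => zero_le) (Finset.mem_univ k)

theorem hsbmLaw_compl_range_eq_zero (π : Fin R → ℝ) (πs : Fin R → Fin K → ℝ)
    (x : Fin R → Fin K → EuclideanSpace ℝ ι) :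
    hsbmLaw π πs x (Set.range (Function.uncurry x))ᶜ = 0 := by
  simp [hsbmLaw]

theorem integrable_hsbmLaw (π : Fin R → ℝ) (πs : Fin R → Fin K → ℝ)
    (x : Fin R → Fin K → EuclideanSpace ℝ ι) (f : EuclideanSpace ℝ ι → ℝ) :
    Integrable f (hsbmLaw π πs x) := by
  refine integrable_finsetSum_measure.2 fun r _ => .smul_measure ?_ ENNReal.ofReal_ne_top
  exact integrable_finsetSum_measure.2 fun k _ =>
    (integrable_dirac enorm_lt_top).smul_measure ENNReal.ofReal_ne_top

end BlockModel

section Recovery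

open Filter Topology

variable {R K d n : ℕ} {ι : Type*} [Fintype ι] {x : Fin R → Fin K → EuclideanSpace ℝ ι}
  {X : Fin n → EuclideanSpace ℝ ι} {G : SimpleGraph (Fin n)} {w δ ε : ℝ}

theorem mem_trueSubgraph {r : Fin R} {i : Fin n} :
    i ∈ trueSubgraph x X r ↔ X i ∈ Set.range (x r) := by
  simp [trueSubgraph, eq_comm]

namespace Affinity

theorem exists_separation (h : Affinity x) : ∃ p q : ℝ, p < q ∧
    (∀ r, ∀ y ∈ Set.range (x r), ∀ z ∈ Set.range (x r), q ≤ inner ℝ y z) ∧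
    ∀ r s, r ≠ s → ∀ y ∈ Set.range (x r), ∀ z ∈ Set.range (x s), inner ℝ y z ≤ p := by
  obtain ⟨p, q, hq, hp, hpq⟩ := h
  refine ⟨p, q, hpq, ?_, ?_⟩
  · rintro r _ ⟨k, rfl⟩ _ ⟨l, rfl⟩
    exact hq.2 ⟨r, k, l, rfl⟩
  · rintro r s hrs _ ⟨k, rfl⟩ _ ⟨l, rfl⟩
    exact hp.2 ⟨r, s, k, l, hrs, rfl⟩

theorem eq_of_mem_range (h : Affinity x) {r s : Fin R} {y : EuclideanSpace ℝ ι}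
    (hr : y ∈ Set.range (x r)) (hs : y ∈ Set.range (x s)) : r = s := by
  obtain ⟨p, q, hpq, hin, hout⟩ := h.exists_separation
  by_contra hrs
  exact hpq.not_ge ((hin r y hr y hr).trans (hout r s hrs y hr y hs))

theorem nonempty_block (h : Affinity x) : Nonempty (Fin K) := by
  obtain ⟨_, _, ⟨⟨_, k, _⟩, _⟩, _⟩ := h
  exact ⟨k⟩

end Affinity

namespace IsTypical

theorem exists_surjective_trueSubgraph_eq (h : IsTypical (Function.uncurry x) w δ X G)
    (haff : Affinity x) (hw : 0 < w) (hδ : 0 < δ) :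
    ∃ cl : Fin n → Fin R, Function.Surjective cl ∧ (∀ i, X i ∈ Set.range (x (cl i))) ∧
      ∀ r, trueSubgraph x X r = Finset.univ.filter fun i => cl i = r := by
  classical
  choose b hb using h.mem_range
  have hcl : ∀ i, X i ∈ Set.range (x (b i).1) := fun i => ⟨(b i).2, hb i⟩
  refine ⟨fun i => (b i).1, fun r => ?_, hcl, fun r => ?_⟩
  · obtain ⟨k⟩ := haff.nonempty_block
    have hcount : (0 : ℝ) < (Finset.univ.filter fun i => X i = x r k).card :=
      (mul_pos hw (h.natCast_pos hδ)).trans_le (h.le_count (r, k))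
    obtain ⟨i, hi⟩ := Finset.card_pos.1 (Nat.cast_pos.1 hcount)
    exact ⟨i, haff.eq_of_mem_range (hcl i) ⟨k, (Finset.mem_filter.1 hi).2.symm⟩⟩
  · ext i
    simp only [mem_trueSubgraph, Finset.mem_filter, Finset.mem_univ, true_and]
    exact ⟨haff.eq_of_mem_range (hcl i), fun hi => hi ▸ hcl i⟩

theorem norm_le_one_of_isLatentOn (h : IsTypical (Function.uncurry x) w δ X G)
    (hx : ∀ b b', inner ℝ (Function.uncurry x b) (Function.uncurry x b') ∈ Set.Icc (0 : ℝ) 1)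
    {H : Finset (Fin n)} {Y : Fin n → EuclideanSpace ℝ (Fin d)} (hY : IsLatentOn H X Y)
    {i : Fin n} (hi : i ∈ H) : ‖Y i‖ ≤ 1 := by
  have hle := (h.inner_mem_Icc hx i i).2
  rw [← hY i hi i hi, real_inner_self_eq_norm_sq] at hle
  exact (sq_le_one_iff₀ (norm_nonneg _)).1 hle

end IsTypical

theorem eventually_exists_perm_Hhat_eq_trueSubgraph
    (hx : ∀ b b', inner ℝ (Function.uncurry x b) (Function.uncurry x b') ∈ Set.Icc (0 : ℝ) 1)
    (hspan : Submodule.span ℝ (Set.range (Function.uncurry x)) = ⊤)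
    (hcard : Fintype.card ι = R * d) (haff : Affinity x) (hw : 0 < w) :
    ∀ᶠ δ in 𝓝[>] (0 : ℝ), ∀ {n : ℕ} {X : Fin n → EuclideanSpace ℝ ι} {G : SimpleGraph (Fin n)},
      IsTypical (Function.uncurry x) w δ X G → ∀ run : AlgorithmRun R d G,
      ∃ σ : Equiv.Perm (Fin R), ∀ r, run.Hhat (σ r) = trueSubgraph x X r := by
  obtain ⟨p, q, hpq, hin, hout⟩ := haff.exists_separation
  have hrank : Module.finrank ℝ (Submodule.span ℝ (Function.uncurry x '' Set.univ)) = R * d := by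
    rw [Set.image_univ, hspan, finrank_top, finrank_euclideanSpace, hcard]
  filter_upwards [eventually_isTypical_abs_inner_sub_inner_le hx hrank hw
    (show 0 < (q - p) / 4 by linarith), self_mem_nhdsWithin] with δ hclose hδ n X G h run
  have hgram : ∀ i j, |inner ℝ (run.Xhat i) (run.Xhat j) - inner ℝ (X i) (X j)| ≤ (q - p) / 4 :=
    hclose h Function.injective_id (Set.ext fun i => by simpa using h.mem_range i)
      (by rw [Matrix.submatrix_id_id]; exact run.isASE)
  obtain ⟨cl, hsurj, hcl, htrue⟩ := h.exists_surjective_trueSubgraph_eq haff hw hδ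
  have hsep : SeparatesClasses run.Xhat cl ((p + q) / 2) := by
    refine ⟨fun i j hij => ?_, fun i j hij => ?_⟩
    · linarith [hin _ _ (hcl i) _ (hij ▸ hcl j), (abs_le.1 (hgram i j)).1]
    · linarith [hout _ _ hij _ (hcl i) _ (hcl j), (abs_le.1 (hgram i j)).2]
  obtain ⟨σ, hσ⟩ := run.exists_perm_Hhat_eq hsurj hsep
  exact ⟨σ, fun r => (hσ r).trans (htrue r).symm⟩

theorem eventually_norm_XhatSub_sub_le
    (hx : ∀ b b', inner ℝ (Function.uncurry x b) (Function.uncurry x b') ∈ Set.Icc (0 : ℝ) 1)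
    {r : Fin R} (hd : Module.finrank ℝ (Submodule.span ℝ (Set.range (x r))) = d)
    (hw : 0 < w) (hε : 0 < ε) :
    ∀ᶠ δ in 𝓝[>] (0 : ℝ), ∀ {n : ℕ} {X : Fin n → EuclideanSpace ℝ ι} {G : SimpleGraph (Fin n)},
      IsTypical (Function.uncurry x) w δ X G → ∀ (run : AlgorithmRun R d G) {r' : Fin R},
      run.Hhat r' = trueSubgraph x X r → ∀ {Y : Fin n → EuclideanSpace ℝ (Fin d)},
      IsAlignedLatent (trueSubgraph x X r) X (run.XhatSub r') Y →
      ∀ i ∈ trueSubgraph x X r, ‖run.XhatSub r' i - Y i‖ ≤ ε := by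
  classical
  have himage : Function.uncurry x '' {b | b.1 = r} = Set.range (x r) := by
    ext y; simp
  obtain ⟨τ, halign, hτ⟩ := ((IsAlignedLatent.eventually_norm_sub_le (d := d) (x r) hw hε).and
    self_mem_nhdsWithin).exists
  filter_upwards [eventually_isTypical_abs_inner_sub_inner_le hx (C := {b | b.1 = r})
    (m := d) (by rw [himage, hd]) hw hτ, self_mem_nhdsWithin]
    with δ hclose hδ n X G h run r' hH Y hY
  have hcount : ∀ k, w * n ≤ ((trueSubgraph x X r).filter fun i => X i = x r k).card := by
    intro k
    convert h.le_count (r, k) using 3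
    ext i
    simp only [Finset.mem_filter, mem_trueSubgraph, Finset.mem_univ, true_and]
    exact ⟨And.right, fun hi => ⟨⟨k, hi.symm⟩, hi⟩⟩
  refine halign _ _ _ _ ?_ (fun k => le_trans ?_ (hcount k)) (fun i hi j hj => ?_) hY
  · refine subset_antisymm (Set.image_subset_iff.2 fun i hi => mem_trueSubgraph.1 hi) ?_
    rintro _ ⟨k, rfl⟩
    have hpos := (mul_pos hw (h.natCast_pos hδ)).trans_le (hcount k)
    obtain ⟨i, hi⟩ := Finset.card_pos.1 (Nat.cast_pos.1 hpos)
    exact ⟨i, (Finset.mem_filter.1 hi).1, (Finset.mem_filter.1 hi).2⟩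
  · gcongr
    exact (Finset.card_le_univ _).trans (Fintype.card_fin n).le
  · rw [← hH] at hi hj
    refine hclose h Subtype.val_injective ?_ (run.isASE_sub r') ⟨i, hi⟩ ⟨j, hj⟩
    ext a
    rw [himage, Subtype.range_coe_subtype]
    exact (congrArg (a ∈ ·) hH).to_iff.trans mem_trueSubgraph

theorem eventually_abs_Shat_sub_dissimilarity_le
    (hx : ∀ b b', inner ℝ (Function.uncurry x b) (Function.uncurry x b') ∈ Set.Icc (0 : ℝ) 1)
    (hd : ∀ r, Module.finrank ℝ (Submodule.span ℝ (Set.range (x r))) = d) {φ : ℝ → ℝ}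
    (hφ : Continuous φ) (hw : 0 < w) (hε : 0 < ε) :
    ∀ᶠ δ in 𝓝[>] (0 : ℝ), ∀ {n : ℕ} {X : Fin n → EuclideanSpace ℝ ι} {G : SimpleGraph (Fin n)},
      IsTypical (Function.uncurry x) w δ X G → ∀ (run : AlgorithmRun R d G) {σ : Fin R → Fin R},
      (∀ r, run.Hhat (σ r) = trueSubgraph x X r) →
      ∀ Y : Fin R → Fin n → EuclideanSpace ℝ (Fin d),
      (∀ r, IsAlignedLatent (trueSubgraph x X r) X (run.XhatSub (σ r)) (Y r)) →
      ∀ r s, |run.Shat φ (σ r) (σ s) - dissimilarity φ (trueSubgraph x X) Y r s| ≤ ε := by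
  obtain ⟨γ, hγ, hkernel⟩ := exists_radial_kernel_close (E := EuclideanSpace ℝ (Fin d)) hφ
    (show 0 < ε / 4 by positivity)
  filter_upwards [eventually_all.2 fun r => eventually_norm_XhatSub_sub_le hx (hd r) hw hγ]
    with δ hclose n X G h run σ hσ Y hY r s
  have hpair : ∀ r s, ∀ i ∈ trueSubgraph x X r, ∀ j ∈ trueSubgraph x X s,
      |φ ‖run.XhatSub (σ r) i - run.XhatSub (σ s) j‖ - φ ‖Y r i - Y s j‖| ≤ ε / 4 :=
    fun r s i hi j hj => hkernel _ _ _ _ (h.norm_le_one_of_isLatentOn hx (hY r).1 hi)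
      (h.norm_le_one_of_isLatentOn hx (hY s).1 hj) (hclose r h run (hσ r) (hY r) i hi)
      (hclose s h run (hσ s) (hY s) j hj)
  simp only [AlgorithmRun.Shat, dissimilarity, Matrix.of_apply, hσ]
  exact (abs_testStatistic_sub_le (by positivity) (hpair r r) (hpair r s) (hpair s s)).trans_eq
    (by ring)

end Recovery

theorem mainTheorem6
    {R K d M : ℕ}
    (π : Fin R → ℝ) (πs : Fin R → Fin K → ℝ)
    (ξ : Fin R → Fin K → Fin d → ℝ) (𝒜 : Fin R → Fin K → Fin R × Fin d → ℝ)
    (hπ : ∀ r, 0 < π r) (hπ_sum : ∑ r, π r = 1)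
    (hπs : ∀ r k, 0 < πs r k) (hπs_sum : ∀ r, ∑ k, πs r k = 1)
    (h_hadamard : ∀ r k c, blockDiagEntry ξ r k c * 𝒜 r k c = 0)
    (h_affinity : Affinity (latentPosition ξ 𝒜))
    (h_rank : (secondMoment (hsbmLaw π πs (latentPosition ξ 𝒜))).rank = R * d)
    (h_motifs : (Set.range ξ).ncard = M)
    (φ : ℝ → ℝ) (hφ : Continuous φ)
    {Ω : ℕ → Type*} [∀ n, MeasurableSpace (Ω n)]
    (μ : ∀ n, Measure (Ω n)) [∀ n, IsProbabilityMeasure (μ n)]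
    (X : ∀ n, Fin n → Ω n → EuclideanSpace ℝ (Fin R × Fin d))
    (A : ∀ n, Ω n → SimpleGraph (Fin n))
    (h_rdpg : ∀ n, IsRDPG (hsbmLaw π πs (latentPosition ξ 𝒜)) (μ n) (X n) (A n)) :
    AsympAlmostSurely μ (fun n => {ω | ∀ run : AlgorithmRun R d (A n ω),
      ∃ σ : Equiv.Perm (Fin R), ∀ r,
        run.Hhat (σ r) = trueSubgraph (latentPosition ξ 𝒜) (fun i => X n i ω) r}) ∧
    ((∀ r, Module.finrank ℝ (Submodule.span ℝ (Set.range (latentPosition ξ 𝒜 r))) ≤ d) →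
      ∀ ε : ℝ, 0 < ε →
        AsympAlmostSurely μ (fun n => {ω | ∀ run : AlgorithmRun R d (A n ω),
          ∃ σ : Equiv.Perm (Fin R),
            (∀ r, run.Hhat (σ r) = trueSubgraph (latentPosition ξ 𝒜) (fun i => X n i ω) r) ∧
            ∀ Y : Fin R → Fin n → EuclideanSpace ℝ (Fin d),
              (∀ r, IsAlignedLatent (trueSubgraph (latentPosition ξ 𝒜) (fun i => X n i ω) r)
                (fun i => X n i ω) (run.XhatSub (σ r)) (Y r)) →
              ∀ r s, |run.Shat φ (σ r) (σ s) -
                dissimilarity φ (trueSubgraph (latentPosition ξ 𝒜) (fun i => X n i ω)) Y r s|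
                  ≤ ε})) := by
  set x := latentPosition ξ 𝒜
  have hatom : ∀ b, hsbmLaw π πs x {Function.uncurry x b} ≠ 0 := fun b =>
    hsbmLaw_singleton_ne_zero hπ hπs b.1 b.2
  have hx : ∀ b b', inner ℝ (Function.uncurry x b) (Function.uncurry x b') ∈ Set.Icc (0 : ℝ) 1 :=
    fun b b' => (h_rdpg 0).inner_mem_Icc (hatom b) (hatom b')
  have hsupp := hsbmLaw_compl_range_eq_zero π πs x
  have hcard : Fintype.card (Fin R × Fin d) = R * d := by simp
  have hspan : Submodule.span ℝ (Set.range (Function.uncurry x)) = ⊤ :=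
    span_eq_top_of_rank_secondMoment (fun _ _ => integrable_hsbmLaw π πs x _) hsupp
      (h_rank.trans hcard.symm)
  have hcluster := fun w (hw : 0 < w) =>
    eventually_exists_perm_Hhat_eq_trueSubgraph hx hspan hcard h_affinity hw
  refine ⟨asympAlmostSurely_of_eventually_isTypical hsupp hatom h_rdpg fun w hw =>
    (hcluster w hw).mono fun δ hδ n ω h => hδ h, fun hdim ε hε => ?_⟩
  have hd : ∀ r, Module.finrank ℝ (Submodule.span ℝ (Set.range (x r))) = d :=
    finrank_eq_of_iSup_eq_top (by rw [← Submodule.span_iUnion, ← hspan]; congr 1; ext y; simp)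
      (by rw [finrank_euclideanSpace, hcard, Fintype.card_fin]) hdim
  refine asympAlmostSurely_of_eventually_isTypical hsupp hatom h_rdpg fun w hw => ?_
  filter_upwards [hcluster w hw, eventually_abs_Shat_sub_dissimilarity_le hx hd hφ hw hε]
    with δ hδ hδε n ω h run
  obtain ⟨σ, hσ⟩ := hδ h run
  exact ⟨σ, hσ, hδε h run hσ⟩
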